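/- Let $\alpha>0$ and let $(a_n)_{n\ge1}$ be a sequence of positive real numbers that is regularly varying with index $\alpha$, i.e. $a_{\lfloor cn\rfloor}/a_n\to c^{\alpha}$ as $n\to\infty$ for every $c>0$. Build random rooted trees $(T_n)_{n\ge1}$ recursively: $T_1$ is a closed segment $\mathsf b_1$ of length $a_1$, rooted at one of its two extremities, and, for $n\ge2$, given $T_{n-1}$, the tree $T_n$ is obtained by gluing one extremity of a closed segment $\mathsf b_n$ of length $a_n$ on a point of $T_{n-1}$ chosen according to the normalized length measure of $T_{n-1}$. Let $d$ be the length metric. Let $L_n$ be the extremity of $\mathsf b_n$ that is not glued (for $n=1$, the one that is not the root), so that $L_1,\dots,L_n$ are the $n$ leaves of $T_n$, and, given $T_n$, let $L_{n,\star}$ be chosen uniformly at random among $L_1,\dots,L_n$. There is a unique probability distribution on $\mathbb R$, the law of a random variable denoted $\xi_{(\alpha)}$, such that $$\mathbb E\big[\exp(\lambda\xi_{(\alpha)})\big]=\exp\left(\frac{\alpha+1}{\alpha}\int_0^1\big(e^{\lambda u}-1\big)\frac{1-u}{u}\,\mathrm du\right)\qquad\text{for all }\lambda\in\mathbb R,$$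 and, as $n\to\infty$, $$\frac{d(L_n,\mathsf{root})}{a_n}\xrightarrow{(\mathrm d)}1+\xi_{(\alpha)}\qquad\text{and}\qquad\frac{d(L_{n,\star},\mathsf{root})}{a_n}\xrightarrow{(\mathrm d)}(1+\xi_{(\alpha)})\,U^{\alpha},$$ where $U$ is uniform on $(0,1)$ and independent of $\xi_{(\alpha)}$. -/

import Mathlib

open MeasureTheory ProbabilityTheory Filter Topology

noncomputable section

/-- `(a_n)_{n ≥ 1}` is regularly varying with index `α`: for all `c > 0`,
`a_{⌊c n⌋} / a_n → c ^ α`. The value `a 0` plays no role. -/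
def RegularlyVarying (a : ℕ → ℝ) (α : ℝ) : Prop :=
  ∀ c : ℝ, 0 < c →
    Tendsto (fun n : ℕ => a ⌊c * (n : ℝ)⌋₊ / a n) atTop (𝓝 (c ^ α))

namespace LineBreaking

/-- The tree `T_n`, as a set of points. A pair `(k, s)` stands for the point of the closed
segment `b_k` of length `a_k` that lies at distance `s` from the extremity of `b_k` by which this
segment is glued (for `k = 1`: from the root). The only identifications, encoded by `treeDist`
below, are between `(k, 0)`, `k ≥ 2`, and the point of `T_{k-1}` on which `b_k` is glued. -/
def tree (a : ℕ → ℝ) (n : ℕ) : Set (ℕ × ℝ) :=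
  {p | 1 ≤ p.1 ∧ p.1 ≤ n ∧ 0 ≤ p.2 ∧ p.2 ≤ a p.1}

/-- The length measure on the disjoint union of the segments. -/
def lengthMeasure : Measure (ℕ × ℝ) := (Measure.count : Measure ℕ).prod (volume : Measure ℝ)

/-- The length metric on `T_n`, where `g k` is the point of `T_k` on which the segment `b_{k+1}`
is glued. `T_{n+1}` is `T_n` together with `b_{n+1}`, whose extremity `(n + 1, 0)` is glued
on `g n`. (For `n = 0` the tree is empty, so `T_1` is just the segment `b_1`.) -/
def treeDist (g : ℕ → ℕ × ℝ) : ℕ → ℕ × ℝ → ℕ × ℝ → ℝ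
  | 0, _, _ => 0
  | n + 1, p, q =>
    if p.1 ≤ n then
      if q.1 ≤ n then treeDist g n p q else treeDist g n p (g n) + q.2
    else
      if q.1 ≤ n then p.2 + treeDist g n (g n) q else |p.2 - q.2|

/-- The root: one of the two extremities of `b_1`. -/
def root : ℕ × ℝ := (1, 0)

/-- The `n`-th leaf `L_n`: the extremity of `b_n` that is not glued
(for `n = 1`: that is not the root). -/
def leaf (a : ℕ → ℝ) (n : ℕ) : ℕ × ℝ := (n, a n)

/-- `X n`, `n ≥ 1`, are the random gluing points of the construction: given `T_n` (that is, given
`X 1, …, X (n - 1)`), the segment `b_{n+1}` is glued on the point `X n`, which is uniform on `T_n`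
for the normalized length measure. The variable `X 0` plays no role. -/
structure IsGluing {Ω : Type*} [MeasurableSpace Ω] (P : Measure Ω) (a : ℕ → ℝ)
    (X : ℕ → Ω → ℕ × ℝ) : Prop where
  measurable : ∀ n, 1 ≤ n → Measurable (X n)
  uniform : ∀ n, 1 ≤ n → pdf.IsUniform (X n) (tree a n) P lengthMeasure
  indep : iIndepFun (fun n : ℕ => X (n + 1)) P

/-- `J` is uniform on `{1, …, n}` and independent of the tree `T_n`, so that `L_J` is a leaf chosen
uniformly at random amongst the `n` leaves `L_1, …, L_n` of `T_n`. -/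
structure IsUniformLeafIndex {Ω : Type*} [MeasurableSpace Ω] (P : Measure Ω)
    (X : ℕ → Ω → ℕ × ℝ) (n : ℕ) (J : Ω → ℕ) : Prop where
  measurable : Measurable J
  uniform : pdf.IsUniform J (Set.Icc 1 n) P Measure.count
  indep : IndepFun J (fun ω (k : Finset.Ico 1 n) => X k ω) P

/-- `φ_(α)(t) = (α + 1) / α * ∫_0^1 (exp (t u) - 1) (1 - u) / u du`. -/
def phi (α t : ℝ) : ℝ :=
  (α + 1) / α * ∫ u in (0 : ℝ)..1, (Real.exp (t * u) - 1) * ((1 - u) / u)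

/-- `ν` is the law of `ξ_(α)`: its Laplace transform is finite everywhere, equal to
`exp (φ_(α))`. -/
def IsXiLaw (α : ℝ) (ν : Measure ℝ) : Prop :=
  ∀ t : ℝ, Integrable (fun x => Real.exp (t * x)) ν ∧
    ∫ x, Real.exp (t * x) ∂ν = Real.exp (phi α t)

end LineBreaking

end

/-!
Let `A_k = a_1 + ⋯ + a_k` be the length of `T_k`, and let `H_n` be the distance to the root of the
point on which `b_{n+1}` is glued. That point is uniform on `T_n`, so it is uniform on `T_{n-1}`
with probability `1 - a_n / A_n`; otherwise it is a uniform point of `b_n`, whose height is that of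
the gluing point of `b_n` plus an independent uniform variable on `(0, a_n)`. Hence
`E[exp (t H_n)] = ∏_{k ≤ n} (1 + a_k / A_k * m (t a_k))` with `m s = ∫_0^1 (exp (s v) - 1) dv`.
Regular variation gives `a_k / A_k ∼ (α + 1) / k` (Karamata) and `a_k / a_n ≈ (k / n) ^ α`, so with
`t / a_n` in place of `t` the logarithm of the product is asymptotically a Riemann sum, with limit
`(α + 1) ∫_0^1 m (t x ^ α) dx / x = φ_(α) t`. Pointwise convergence of Laplace transforms on `ℝ`
yields both the existence of `ξ_(α)` and the convergence in distribution of `H_n / a_n`, hence that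
of the height `a_{n+1} + H_n` of the leaf `L_{n+1}`.

For the uniform leaf, condition on its index `k`: the expectation of a bounded continuous function
becomes an average over `k ≤ n`, and the leaf with index `⌊x n⌋` has height
`≈ (1 + ξ_(α)) x ^ α a_n`, so this average is again a Riemann sum, in which `x` plays the role
of `U`.
-/

theorem tendsto_min_natCast (y : ℝ) : Tendsto (fun K : ℕ => min y K) atTop (𝓝 y) := by
  refine tendsto_const_nhds.congr' ?_
  filter_upwards [eventually_ge_atTop ⌈y⌉₊] with K hK
  exact (min_eq_left (Nat.ceil_le.1 hK)).symm

theorem le_min_add_sq_div {x K : ℝ} (hK : 0 < K) : x ≤ min x K + x ^ 2 / K := by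
  rcases le_total x K with h | h
  · rw [min_eq_left h]
    have : 0 ≤ x ^ 2 / K := by positivity
    linarith
  · rw [min_eq_right h]
    have : x ≤ x ^ 2 / K := by
      rw [le_div_iff₀ hK]
      nlinarith
    linarith

section Truncation

variable {E : Type*} [MeasurableSpace E] {μ : Measure E} [IsFiniteMeasure μ] {f : E → ℝ}

theorem integrable_min_natCast (hf : AEStronglyMeasurable f μ) (hf0 : ∀ x, 0 ≤ f x) (K : ℕ) :
    Integrable (fun x => min (f x) K) μ := by
  refine Integrable.of_bound (hf.inf aestronglyMeasurable_const) K (ae_of_all _ fun x => ?_)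
  rw [Real.norm_of_nonneg (le_min (hf0 x) K.cast_nonneg)]
  exact min_le_right _ _

theorem integrable_of_forall_integral_min_natCast_le (hf : AEStronglyMeasurable f μ)
    (hf0 : ∀ x, 0 ≤ f x) {C : ℝ} (h : ∀ K : ℕ, ∫ x, min (f x) K ∂μ ≤ C) : Integrable f μ := by
  have hlim : Tendsto (fun K : ℕ => ∫⁻ x, ENNReal.ofReal (min (f x) K) ∂μ) atTop
      (𝓝 (∫⁻ x, ENNReal.ofReal (f x) ∂μ)) := by
    refine lintegral_tendsto_of_tendsto_of_monotone
      (fun K => (hf.inf aestronglyMeasurable_const).aemeasurable.ennreal_ofReal)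
      (ae_of_all _ fun x K K' hK => ?_)
      (ae_of_all _ fun x => ENNReal.tendsto_ofReal (tendsto_min_natCast (f x)))
    exact ENNReal.ofReal_le_ofReal (min_le_min_left _ (Nat.cast_le.2 hK))
  refine ⟨hf, (hasFiniteIntegral_iff_ofReal (ae_of_all _ hf0)).2
    ((le_of_tendsto' hlim fun K => ?_).trans_lt (ENNReal.ofReal_lt_top (r := C)))⟩
  rw [← ofReal_integral_eq_lintegral_ofReal (integrable_min_natCast hf hf0 K)
    (ae_of_all _ fun x => le_min (hf0 x) K.cast_nonneg)]
  exact ENNReal.ofReal_le_ofReal (h K)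

theorem tendsto_integral_min_natCast (hf : Integrable f μ) (hf0 : ∀ x, 0 ≤ f x) :
    Tendsto (fun K : ℕ => ∫ x, min (f x) K ∂μ) atTop (𝓝 (∫ x, f x ∂μ)) := by
  refine tendsto_integral_of_dominated_convergence _
    (fun K => (integrable_min_natCast hf.1 hf0 K).1) hf (fun K => ae_of_all _ fun x => ?_)
    (ae_of_all _ fun x => tendsto_min_natCast (f x))
  rw [Real.norm_of_nonneg (le_min (hf0 x) K.cast_nonneg)]
  exact min_le_left _ _

theorem integral_le_integral_min_add_integral_sq_div (hf : Integrable f μ) (hf0 : ∀ x, 0 ≤ f x)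
    (hf2 : Integrable (fun x => f x ^ 2) μ) {K : ℕ} (hK : 0 < K) :
    ∫ x, f x ∂μ ≤ ∫ x, min (f x) K ∂μ + (∫ x, f x ^ 2 ∂μ) / K := by
  have hmin := integrable_min_natCast hf.1 hf0 K
  rw [← integral_div, ← integral_add hmin (hf2.div_const _)]
  exact integral_mono hf (hmin.add (hf2.div_const _))
    fun x => le_min_add_sq_div (Nat.cast_pos.2 hK)

end Truncation

section WeakLimit

variable {E ι : Type*} [TopologicalSpace E] [MeasurableSpace E] [OpensMeasurableSpace E]
  {l : Filter ι} {μ : ι → ProbabilityMeasure E} {ν : ProbabilityMeasure E} {f : E → ℝ} {m s : ℝ}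

theorem tendsto_integral_min_natCast_of_tendsto (hμν : Tendsto μ l (𝓝 ν)) (hf : Continuous f)
    (hf0 : ∀ x, 0 ≤ f x) (K : ℕ) :
    Tendsto (fun i => ∫ x, min (f x) K ∂(μ i : Measure E)) l
      (𝓝 (∫ x, min (f x) K ∂(ν : Measure E))) := by
  let g : BoundedContinuousFunction E ℝ :=
    .ofNormedAddCommGroup (fun x => min (f x) K) (by fun_prop) K fun x => by
      rw [Real.norm_of_nonneg (le_min (hf0 x) K.cast_nonneg)]
      exact min_le_right _ _
  exact ProbabilityMeasure.tendsto_iff_forall_integral_tendsto.1 hμν g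

variable [l.NeBot]

theorem integral_min_natCast_le_of_tendsto (hμν : Tendsto μ l (𝓝 ν)) (hf : Continuous f)
    (hf0 : ∀ x, 0 ≤ f x) (hint : ∀ i, Integrable f (μ i : Measure E))
    (hm : Tendsto (fun i => ∫ x, f x ∂(μ i : Measure E)) l (𝓝 m)) (K : ℕ) :
    ∫ x, min (f x) K ∂(ν : Measure E) ≤ m :=
  le_of_tendsto_of_tendsto' (tendsto_integral_min_natCast_of_tendsto hμν hf hf0 K) hm fun i =>
    integral_mono (integrable_min_natCast (hint i).1 hf0 K) (hint i) fun _ => min_le_left _ _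

theorem integrable_of_tendsto_of_tendsto_integral (hμν : Tendsto μ l (𝓝 ν)) (hf : Continuous f)
    (hf0 : ∀ x, 0 ≤ f x) (hint : ∀ i, Integrable f (μ i : Measure E))
    (hm : Tendsto (fun i => ∫ x, f x ∂(μ i : Measure E)) l (𝓝 m)) :
    Integrable f (ν : Measure E) :=
  integrable_of_forall_integral_min_natCast_le hf.measurable.aestronglyMeasurable hf0
    (integral_min_natCast_le_of_tendsto hμν hf hf0 hint hm)

theorem integral_eq_of_tendsto_of_tendsto_integral_sq (hμν : Tendsto μ l (𝓝 ν))
    (hf : Continuous f) (hf0 : ∀ x, 0 ≤ f x) (hint : ∀ i, Integrable f (μ i : Measure E))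
    (hint2 : ∀ i, Integrable (fun x => f x ^ 2) (μ i : Measure E))
    (hm : Tendsto (fun i => ∫ x, f x ∂(μ i : Measure E)) l (𝓝 m))
    (hs : Tendsto (fun i => ∫ x, f x ^ 2 ∂(μ i : Measure E)) l (𝓝 s)) :
    ∫ x, f x ∂(ν : Measure E) = m := by
  have hmin := tendsto_integral_min_natCast
    (integrable_of_tendsto_of_tendsto_integral hμν hf hf0 hint hm) hf0
  refine le_antisymm
    (le_of_tendsto' hmin (integral_min_natCast_le_of_tendsto hμν hf hf0 hint hm)) ?_
  have hlim := hmin.add (tendsto_const_div_atTop_nhds_zero_nat s)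
  rw [add_zero] at hlim
  refine ge_of_tendsto hlim ?_
  filter_upwards [eventually_gt_atTop 0] with K hK
  exact le_of_tendsto_of_tendsto' hm
    ((tendsto_integral_min_natCast_of_tendsto hμν hf hf0 K).add (hs.div_const K))
    fun i => integral_le_integral_min_add_integral_sq_div (hint i) hf0 (hint2 i) hK

end WeakLimit

section Mgf

theorem ext_of_mgf_id_eq {μ ν : Measure ℝ} [IsProbabilityMeasure μ] [IsFiniteMeasure ν]
    (hμ : ∀ t, Integrable (fun x => Real.exp (t * x)) μ) (h : mgf id μ = mgf id ν) : μ = ν := by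
  have huniv : integrableExpSet id μ = Set.univ := Set.eq_univ_of_forall hμ
  refine Measure.ext_of_complexMGF_id_eq (funext fun z => eqOn_complexMGF_of_mgf h ?_)
  simp only [huniv, interior_univ, Set.mem_univ, Set.ofPred_true]

theorem measureReal_norm_gt_le_exp_neg_mul {μ : Measure ℝ} [IsFiniteMeasure μ]
    (hμ : ∀ t, Integrable (fun x => Real.exp (t * x)) μ) (r : ℝ) :
    μ.real {x | r < ‖x‖} ≤ Real.exp (-r) * (mgf id μ 1 + mgf id μ (-1)) := by
  have hsub : {x : ℝ | r < ‖x‖} ⊆ {x | r ≤ id x} ∪ {x | id x ≤ -r} := by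
    rintro x (hx : r < |x|)
    exact (lt_abs.1 hx).imp le_of_lt fun h => show x ≤ -r by linarith
  refine ((measureReal_mono hsub).trans (measureReal_union_le _ _)).trans ?_
  have hright := measure_ge_le_exp_mul_mgf (X := id) r zero_le_one (hμ 1)
  have hleft := measure_le_le_exp_mul_mgf (X := id) (-r) (neg_nonpos.2 zero_le_one) (hμ (-1))
  simp only [neg_mul, one_mul, neg_neg] at hright hleft
  linarith

variable {μ : ℕ → ProbabilityMeasure ℝ} {M : ℝ → ℝ}

theorem isTightMeasureSet_of_tendsto_mgf
    (hint : ∀ n t, Integrable (fun x => Real.exp (t * x)) (μ n : Measure ℝ))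
    (hM : ∀ t, Tendsto (fun n => mgf id (μ n : Measure ℝ) t) atTop (𝓝 (M t))) :
    IsTightMeasureSet {((m : ProbabilityMeasure ℝ) : Measure ℝ) | m ∈ Set.range μ} := by
  obtain ⟨C, hC⟩ := ((hM 1).add (hM (-1))).bddAbove_range
  have hlim : Tendsto (fun r : ℝ => ENNReal.ofReal (Real.exp (-r) * C)) atTop (𝓝 0) := by
    rw [← ENNReal.ofReal_zero, ← zero_mul C]
    exact ENNReal.tendsto_ofReal (Real.tendsto_exp_neg_atTop_nhds_zero.mul_const C)
  refine isTightMeasureSet_of_tendsto_measure_norm_gt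
    (tendsto_of_tendsto_of_tendsto_of_le_of_le tendsto_const_nhds hlim (fun _ => zero_le)
      fun r => iSup₂_le ?_)
  rintro _ ⟨_, ⟨n, rfl⟩, rfl⟩
  rw [← ofReal_measureReal]
  refine ENNReal.ofReal_le_ofReal ((measureReal_norm_gt_le_exp_neg_mul (hint n) r).trans ?_)
  exact mul_le_mul_of_nonneg_left (hC ⟨n, rfl⟩) (Real.exp_pos _).le

theorem mgf_eq_of_tendsto_of_tendsto_mgf {l : Filter ℕ} [l.NeBot] {ν : ProbabilityMeasure ℝ}
    (hμν : Tendsto μ l (𝓝 ν))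
    (hint : ∀ n t, Integrable (fun x => Real.exp (t * x)) (μ n : Measure ℝ))
    (hM : ∀ t, Tendsto (fun n => mgf id (μ n : Measure ℝ) t) l (𝓝 (M t))) (t : ℝ) :
    Integrable (fun x => Real.exp (t * x)) (ν : Measure ℝ) ∧ mgf id (ν : Measure ℝ) t = M t := by
  have hsq (x : ℝ) : Real.exp (t * x) ^ 2 = Real.exp (2 * t * x) := by
    rw [← Real.exp_nat_mul, Nat.cast_ofNat, mul_assoc]
  have hcont : Continuous fun x : ℝ => Real.exp (t * x) := by fun_prop
  refine ⟨integrable_of_tendsto_of_tendsto_integral hμν hcont (fun x => (Real.exp_pos _).le)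
      (hint · t) (hM t),
    integral_eq_of_tendsto_of_tendsto_integral_sq (s := M (2 * t)) hμν hcont
      (fun x => (Real.exp_pos _).le) (hint · t) ?_ (hM t) ?_⟩
  · simpa only [id_eq, hsq] using (hint · (2 * t))
  · simpa only [id_eq, hsq, mgf] using hM (2 * t)

theorem exists_tendsto_of_tendsto_mgf
    (hint : ∀ n t, Integrable (fun x => Real.exp (t * x)) (μ n : Measure ℝ))
    (hM : ∀ t, Tendsto (fun n => mgf id (μ n : Measure ℝ) t) atTop (𝓝 (M t))) :
    ∃ ν : ProbabilityMeasure ℝ, Tendsto μ atTop (𝓝 ν) ∧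
      ∀ t, Integrable (fun x => Real.exp (t * x)) (ν : Measure ℝ) ∧
        mgf id (ν : Measure ℝ) t = M t := by
  have hcomp : IsCompact (closure (Set.range μ)) :=
    isCompact_closure_of_isTightMeasureSet (isTightMeasureSet_of_tendsto_mgf hint hM)
  have exists_limit (U : Ultrafilter ℕ) (hU : (U : Filter ℕ) ≤ atTop) :
      ∃ ν : ProbabilityMeasure ℝ, Tendsto μ U (𝓝 ν) ∧
        ∀ t, Integrable (fun x => Real.exp (t * x)) (ν : Measure ℝ) ∧
          mgf id (ν : Measure ℝ) t = M t := by
    obtain ⟨ν, -, hν⟩ := hcomp.ultrafilter_le_nhds (U.map μ)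
      (.trans (by simp) (monotone_principal subset_closure))
    exact ⟨ν, hν, mgf_eq_of_tendsto_of_tendsto_mgf hν hint fun t => (hM t).mono_left hU⟩
  obtain ⟨ν, -, hν⟩ := exists_limit (hyperfilter ℕ) Nat.hyperfilter_le_atTop
  refine ⟨ν, (Filter.tendsto_iff_ultrafilter _ _ _).2 fun U hU => ?_, hν⟩
  obtain ⟨ν', hν', hνM⟩ := exists_limit U hU
  have hνν' : (ν : Measure ℝ) = ν' := ext_of_mgf_id_eq (fun t => (hν t).1)
    (funext fun t => (hν t).2.trans (hνM t).2.symm)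
  rwa [Subtype.ext hνν']

variable {Ω Ω' : Type*} [MeasurableSpace Ω] [MeasurableSpace Ω'] {P : Measure Ω}
  [IsProbabilityMeasure P] {P' : Measure Ω'} [IsProbabilityMeasure P'] {Y : ℕ → Ω → ℝ} {Z : Ω' → ℝ}

theorem exists_tendstoInDistribution_of_tendsto_mgf (hY : ∀ n, AEMeasurable (Y n) P)
    (hint : ∀ n t, Integrable (fun ω => Real.exp (t * Y n ω)) P)
    (hM : ∀ t, Tendsto (fun n => mgf (Y n) P t) atTop (𝓝 (M t))) :
    ∃ ν : ProbabilityMeasure ℝ, TendstoInDistribution Y atTop id (fun _ => P) (ν : Measure ℝ) ∧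
      ∀ t, Integrable (fun x => Real.exp (t * x)) (ν : Measure ℝ) ∧
        mgf id (ν : Measure ℝ) t = M t := by
  obtain ⟨ν, hν, hνM⟩ := exists_tendsto_of_tendsto_mgf
    (μ := fun n => ⟨P.map (Y n), Measure.isProbabilityMeasure_map (hY n)⟩)
    (fun n t => (integrable_map_measure (by fun_prop) (hY n)).2 (hint n t))
    (fun t => by simpa only [ProbabilityMeasure.coe_mk, mgf_id_map (hY _)] using hM t)
  refine ⟨ν, ⟨hY, aemeasurable_id, ?_⟩, hνM⟩
  convert! hν
  exact congrArg 𝓝 (Subtype.ext Measure.map_id)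

theorem tendstoInDistribution_of_tendsto_mgf (hY : ∀ n, AEMeasurable (Y n) P)
    (hint : ∀ n t, Integrable (fun ω => Real.exp (t * Y n ω)) P) (hZ : AEMeasurable Z P')
    (hM : ∀ t, Tendsto (fun n => mgf (Y n) P t) atTop (𝓝 (mgf Z P' t))) :
    TendstoInDistribution Y atTop Z (fun _ => P) P' := by
  obtain ⟨ν, hν, hνM⟩ := exists_tendstoInDistribution_of_tendsto_mgf hY hint hM
  have := Measure.isProbabilityMeasure_map hZ
  have hνZ : (ν : Measure ℝ) = P'.map Z := ext_of_mgf_id_eq (fun t => (hνM t).1)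
    (by rw [mgf_id_map hZ]; exact funext fun t => (hνM t).2)
  refine ⟨hY, hZ, ?_⟩
  simpa only [Measure.map_id, hνZ] using hν.tendsto

end Mgf

theorem tendsto_floor_mul_natCast_div {c : ℝ} (hc : 0 ≤ c) :
    Tendsto (fun n : ℕ => (⌊c * (n : ℝ)⌋₊ : ℝ) / n) atTop (𝓝 c) :=
  (tendsto_nat_floor_mul_div_atTop hc).comp tendsto_natCast_atTop_atTop

theorem tendsto_floor_mul_natCast_atTop {c : ℝ} (hc : 0 < c) :
    Tendsto (fun n : ℕ => ⌊c * (n : ℝ)⌋₊) atTop atTop :=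
  tendsto_nat_floor_atTop.comp (tendsto_natCast_atTop_atTop.const_mul_atTop hc)

theorem rpow_mem_Icc_inv_rpow_abs {b c : ℝ} (hc : c ∈ Set.Icc 1 b) (α : ℝ) :
    c ^ α ∈ Set.Icc (b ^ |α|)⁻¹ (b ^ |α|) := by
  have hc0 : 0 < c := one_pos.trans_le hc.1
  have hle : c ^ |α| ≤ b ^ |α| := Real.rpow_le_rpow hc0.le hc.2 (abs_nonneg α)
  constructor
  · calc (b ^ |α|)⁻¹ ≤ (c ^ |α|)⁻¹ := inv_anti₀ (by positivity) hle
      _ = c ^ (-|α|) := (Real.rpow_neg hc0.le _).symm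
      _ ≤ c ^ α := Real.rpow_le_rpow_of_exponent_le hc.1 (neg_abs_le α)
  · exact (Real.rpow_le_rpow_of_exponent_le hc.1 (le_abs_self α)).trans hle

theorem exists_mem_Icc_div_notMem_div_notMem {t : Set ℝ} (ht : volume t ≤ ENNReal.ofReal (1 / 2))
    {l n : ℝ} (hl : 0 < l) (hn : 0 < n) (hnl : n ≤ 2 * l) :
    ∃ x ∈ Set.Icc (2 * l) (4 * l), x / l ∉ t ∧ x / n ∉ t := by
  by_contra! hcover
  have hvol {m : ℝ} (hm : 0 < m) :
      volume ((fun x : ℝ => x * m⁻¹) ⁻¹' t) ≤ ENNReal.ofReal (m * (1 / 2)) := by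
    rw [Real.volume_preimage_mul_right (inv_pos.2 hm).ne', inv_inv, abs_of_pos hm,
      ENNReal.ofReal_mul hm.le]
    gcongr
  have hsub : Set.Icc (2 * l) (4 * l) ⊆
      ((fun x : ℝ => x * l⁻¹) ⁻¹' t) ∪ ((fun x : ℝ => x * n⁻¹) ⁻¹' t) := fun x hx =>
    or_iff_not_imp_left.2 (hcover x hx)
  have hle := (measure_mono hsub).trans
    ((measure_union_le _ _).trans (add_le_add (hvol hl) (hvol hn)))
  rw [Real.volume_Icc, ← ENNReal.ofReal_add (by positivity) (by positivity),
    ENNReal.ofReal_le_ofReal_iff (by positivity)] at hle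
  linarith

theorem exists_forall_le_mul_of_forall_ge {b : ℕ → ℝ} (hb : ∀ n, 1 ≤ n → 0 < b n) {C : ℝ} {N : ℕ}
    (hN : 1 ≤ N) (h : ∀ k n, N ≤ k → k ≤ n → b k ≤ C * b n) :
    ∃ D, 0 < D ∧ ∀ k n, 1 ≤ k → k ≤ n → b k ≤ D * b n := by
  obtain ⟨S, hS⟩ :=
    ((Finset.Icc 1 N ×ˢ Finset.Icc 1 N).image fun p => b p.1 / b p.2).bddAbove
  have hbS (i j : ℕ) (hi : 1 ≤ i) (hiN : i ≤ N) (hj : 1 ≤ j) (hjN : j ≤ N) : b i ≤ S * b j := by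
    rw [← div_le_iff₀ (hb j hj)]
    refine hS (Finset.mem_coe.2 (Finset.mem_image.2 ⟨(i, j), ?_, rfl⟩))
    simp only [Finset.mem_product, Finset.mem_Icc]
    exact ⟨⟨hi, hiN⟩, hj, hjN⟩
  have hS1 : 1 ≤ S := (le_mul_iff_one_le_left (hb N hN)).1 (hbS N N hN le_rfl hN le_rfl)
  have hC1 : 1 ≤ C := (le_mul_iff_one_le_left (hb N hN)).1 (h N N le_rfl le_rfl)
  refine ⟨S * C, by positivity, fun k n hk hkn => ?_⟩
  have hbn := hb n (hk.trans hkn)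
  rcases le_total n N with hnN | hNn
  · calc b k ≤ S * b n := hbS k n hk (hkn.trans hnN) (hk.trans hkn) hnN
      _ ≤ S * C * b n := by
        gcongr
        exact le_mul_of_one_le_right (by positivity) hC1
  · rcases le_total N k with hNk | hkN
    · calc b k ≤ C * b n := h k n hNk hkn
        _ ≤ S * C * b n := by
          gcongr
          exact le_mul_of_one_le_left (by positivity) hS1
    · calc b k ≤ S * b N := hbS k N hk hkN hN le_rfl
        _ ≤ S * (C * b n) := by gcongr; exact h N n le_rfl hNn
        _ = S * C * b n := by ring

namespace RegularlyVarying

variable {a : ℕ → ℝ} {α : ℝ}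

theorem div_rpow (hreg : RegularlyVarying a α) (β : ℝ) :
    RegularlyVarying (fun n => a n / (n : ℝ) ^ β) (α - β) := by
  intro c hc
  have hpow : Tendsto (fun n : ℕ => ((⌊c * (n : ℝ)⌋₊ : ℝ) / n) ^ β) atTop (𝓝 (c ^ β)) :=
    (tendsto_floor_mul_natCast_div hc.le).rpow_const (Or.inl hc.ne')
  rw [Real.rpow_sub hc]
  refine ((hreg c hc).div hpow (by positivity)).congr fun n => ?_
  simp only [Pi.div_apply]
  rw [Real.div_rpow (Nat.cast_nonneg _) (Nat.cast_nonneg _), div_div_div_comm]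

-- Egorov's theorem replaces the uniform convergence theorem for regularly varying sequences.
theorem exists_forall_mem_Icc_of_notMem (hreg : RegularlyVarying a α) :
    ∃ K, 0 < K ∧ ∃ t : Set ℝ, volume t ≤ ENNReal.ofReal (1 / 2) ∧ ∃ N : ℕ, ∀ n, N ≤ n →
      ∀ c ∈ Set.Icc (1 : ℝ) 4, c ∉ t → a ⌊c * (n : ℝ)⌋₊ / a n ∈ Set.Icc K⁻¹ K := by
  have hmeas (n : ℕ) : StronglyMeasurable fun c : ℝ => a ⌊c * (n : ℝ)⌋₊ / a n :=
    (((measurable_from_nat (f := a)).comp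
      (Nat.measurable_floor.comp (measurable_mul_const _))).div_const _).stronglyMeasurable
  obtain ⟨t, -, -, ht, hunif⟩ := tendstoUniformlyOn_of_ae_tendsto (μ := volume) hmeas
    (g := fun c => c ^ α) (Measurable.stronglyMeasurable (by fun_prop))
    (measurableSet_Icc (a := (1 : ℝ)) (b := 4)) (by simp [Real.volume_Icc])
    (ae_of_all _ fun c hc => hreg c (one_pos.trans_le hc.1)) one_half_pos
  set M : ℝ := 4 ^ |α|
  have hM1 : 1 ≤ M := Real.one_le_rpow (by norm_num) (abs_nonneg α)
  have hinv : (2 * M)⁻¹ = M⁻¹ / 2 := by rw [mul_inv]; ring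
  have hinv1 : M⁻¹ ≤ 1 := inv_le_one_of_one_le₀ hM1
  obtain ⟨N, hN⟩ := eventually_atTop.1
    (Metric.tendstoUniformlyOn_iff.1 hunif (M⁻¹ / 2) (by positivity))
  refine ⟨2 * M, by positivity, t, ht, N, fun n hn c hc hct => ?_⟩
  have hclose := abs_lt.1 (hN n hn c ⟨hc, hct⟩)
  have hpow := rpow_mem_Icc_inv_rpow_abs hc α
  rw [hinv]
  exact ⟨by linarith [hpow.1], by linarith [hpow.2]⟩

theorem exists_forall_le_mul_of_le_two_mul (hreg : RegularlyVarying a α)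
    (ha : ∀ n, 1 ≤ n → 0 < a n) :
    ∃ C, 0 < C ∧ ∃ N : ℕ, 1 ≤ N ∧ ∀ l n, N ≤ l → l ≤ n → n ≤ 2 * l → a l ≤ C * a n := by
  obtain ⟨K, hK, t, ht, N, hN⟩ := hreg.exists_forall_mem_Icc_of_notMem
  refine ⟨K * K, by positivity, max N 1, le_max_right _ _, fun l n hNl hln hnl => ?_⟩
  obtain ⟨hNl, hl⟩ := max_le_iff.1 hNl
  have hl0 : (0 : ℝ) < l := Nat.cast_pos.2 hl
  have hln' : (l : ℝ) ≤ n := Nat.cast_le.2 hln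
  have hnl' : (n : ℝ) ≤ 2 * l := by exact_mod_cast hnl
  have hn0 : (0 : ℝ) < n := hl0.trans_le hln'
  -- `a l` and `a n` are both comparable to `a ⌊x⌋₊`, for `x / l` and `x / n` outside `t`.
  obtain ⟨x, hx, hxl, hxn⟩ := exists_mem_Icc_div_notMem_div_notMem ht hl0 hn0 hnl'
  have hl_le : a l ≤ K * a ⌊x⌋₊ := by
    have h := (hN l hNl (x / l) ⟨(one_le_div hl0).2 (by linarith [hx.1]),
      (div_le_iff₀ hl0).2 hx.2⟩ hxl).1
    rwa [div_mul_cancel₀ _ hl0.ne', le_div_iff₀ (ha l hl), inv_mul_le_iff₀ hK] at h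
  have hle_n : a ⌊x⌋₊ ≤ K * a n := by
    have h := (hN n (hNl.trans hln) (x / n) ⟨(one_le_div hn0).2 (by linarith [hx.1]),
      (div_le_iff₀ hn0).2 (by linarith [hx.2])⟩ hxn).2
    rwa [div_mul_cancel₀ _ hn0.ne', div_le_iff₀ (ha n (hl.trans hln))] at h
  calc a l ≤ K * a ⌊x⌋₊ := hl_le
    _ ≤ K * (K * a n) := by gcongr
    _ = K * K * a n := by ring

theorem eventually_le_two_mul (hreg : RegularlyVarying a α) (hα : 0 < α)
    (ha : ∀ n, 1 ≤ n → 0 < a n) : ∀ᶠ n in atTop, a n ≤ a (2 * n) := by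
  have hlim := (hreg 2 two_pos).eventually_const_lt (Real.one_lt_rpow one_lt_two hα)
  filter_upwards [hlim, eventually_ge_atTop 1] with n hn hn1
  have hfloor : ⌊(2 : ℝ) * (n : ℝ)⌋₊ = 2 * n := by exact_mod_cast Nat.floor_natCast (2 * n)
  rw [hfloor, one_lt_div (ha n hn1)] at hn
  exact hn.le

theorem exists_forall_le_mul (hreg : RegularlyVarying a α) (hα : 0 < α)
    (ha : ∀ n, 1 ≤ n → 0 < a n) :
    ∃ C, 0 < C ∧ ∀ k n, 1 ≤ k → k ≤ n → a k ≤ C * a n := by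
  obtain ⟨C, -, N₁, hN₁, hlocal⟩ := hreg.exists_forall_le_mul_of_le_two_mul ha
  obtain ⟨N₂, hdouble⟩ := eventually_atTop.1 (hreg.eventually_le_two_mul hα ha)
  refine exists_forall_le_mul_of_forall_ge ha (C := C) (N := max N₁ N₂)
    (hN₁.trans (le_max_left _ _)) fun k n hk hkn => ?_
  induction hd : n - k using Nat.strong_induction_on generalizing k with
  | _ d ih =>
    obtain ⟨hk₁, hk₂⟩ := max_le_iff.1 hk
    rcases le_or_gt n (2 * k) with hnk | hnk
    · exact hlocal k n hk₁ hkn hnk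
    · exact (hdouble k hk₂).trans (ih (n - 2 * k) (by omega) (2 * k) (by omega) hnk.le rfl)

theorem exists_forall_le_mul_rpow_mul (hreg : RegularlyVarying a α)
    (ha : ∀ n, 1 ≤ n → 0 < a n) {β : ℝ} (hβ : β < α) :
    ∃ C, 0 < C ∧ ∀ k n : ℕ, 1 ≤ k → k ≤ n → a k ≤ C * ((k : ℝ) / n) ^ β * a n := by
  have hpow (n : ℕ) (hn : 1 ≤ n) : (0 : ℝ) < (n : ℝ) ^ β :=
    Real.rpow_pos_of_pos (Nat.cast_pos.2 hn) β
  obtain ⟨C, hC, h⟩ := (hreg.div_rpow β).exists_forall_le_mul (sub_pos.2 hβ)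
    fun n hn => div_pos (ha n hn) (hpow n hn)
  refine ⟨C, hC, fun k n hk hkn => ?_⟩
  have hle := h k n hk hkn
  rw [div_le_iff₀ (hpow k hk)] at hle
  rw [Real.div_rpow k.cast_nonneg n.cast_nonneg]
  calc a k ≤ C * (a n / (n : ℝ) ^ β) * (k : ℝ) ^ β := hle
    _ = C * ((k : ℝ) ^ β / (n : ℝ) ^ β) * a n := by ring

end RegularlyVarying

section RiemannSum

theorem integral_comp_floor (f : ℕ → ℝ) (n : ℕ) :
    ∫ y in (0 : ℝ)..n, f ⌊y⌋₊ = ∑ k ∈ Finset.range n, f k := by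
  have hae (k : ℕ) : ∀ᵐ y ∂(volume : Measure ℝ), y ∈ Set.uIoc (k : ℝ) (k + 1 : ℕ) →
      f k = f ⌊y⌋₊ := by
    filter_upwards [Measure.ae_ne volume ((k + 1 : ℕ) : ℝ)] with y hne hy
    rw [Set.uIoc_of_le (Nat.cast_le.2 k.le_succ)] at hy
    have hlt : y < k + 1 := by simpa using hy.2.lt_of_ne hne
    rw [(Nat.floor_eq_iff (k.cast_nonneg.trans hy.1.le)).2 ⟨hy.1.le, hlt⟩]
  have hint (k : ℕ) : IntervalIntegrable (fun y : ℝ => f ⌊y⌋₊) volume k (k + 1 : ℕ) :=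
    (intervalIntegrable_const (c := f k)).congr_ae ((ae_restrict_iff' measurableSet_uIoc).2 (hae k))
  rw [← Nat.cast_zero, ← intervalIntegral.sum_integral_adjacent_intervals
    (a := fun k : ℕ => (k : ℝ)) fun k _ => hint k]
  refine Finset.sum_congr rfl fun k _ => ?_
  rw [← intervalIntegral.integral_congr_ae (hae k)]
  simp

theorem sum_Ico_one_eq_integral_comp_floor_mul (f : ℕ → ℝ) {n : ℕ} (hn : n ≠ 0) :
    ∑ k ∈ Finset.Ico 1 n, f k =
      ∫ x in (0 : ℝ)..1, if ⌊x * (n : ℝ)⌋₊ = 0 then 0 else n * f ⌊x * (n : ℝ)⌋₊ := by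
  have hn0 : (n : ℝ) ≠ 0 := Nat.cast_ne_zero.2 hn
  rw [intervalIntegral.integral_comp_mul_right (fun y => if ⌊y⌋₊ = 0 then 0 else n * f ⌊y⌋₊) hn0,
    zero_mul, one_mul, smul_eq_mul, integral_comp_floor fun k => if k = 0 then 0 else n * f k,
    Finset.range_eq_Ico, Finset.sum_eq_sum_Ico_succ_bot (Nat.pos_of_ne_zero hn), if_pos rfl,
    zero_add, zero_add, Finset.mul_sum]
  refine Finset.sum_congr rfl fun k hk => ?_
  rw [if_neg (Nat.one_le_iff_ne_zero.1 (Finset.mem_Ico.1 hk).1), inv_mul_cancel_left₀ hn0]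

theorem rpow_floor_mul_div_le {β x : ℝ} (hβ : β ≤ 0) (hx : 0 < x) {n : ℕ}
    (hn : ⌊x * (n : ℝ)⌋₊ ≠ 0) :
    ((⌊x * (n : ℝ)⌋₊ : ℝ) / n) ^ β ≤ (1 / 2) ^ β * x ^ β := by
  have hn0 : (0 : ℝ) < n := by
    rcases n.eq_zero_or_pos with rfl | h
    · simp at hn
    · exact Nat.cast_pos.2 h
  have hone : (1 : ℝ) ≤ ⌊x * (n : ℝ)⌋₊ := Nat.one_le_cast.2 (Nat.one_le_iff_ne_zero.2 hn)
  have hhalf : 1 / 2 * x ≤ (⌊x * (n : ℝ)⌋₊ : ℝ) / n := by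
    rw [le_div_iff₀ hn0]
    linarith [Nat.lt_floor_add_one (x * (n : ℝ))]
  rw [← Real.mul_rpow one_half_pos.le hx.le]
  exact Real.rpow_le_rpow_of_nonpos (by positivity) hhalf hβ

variable {F : ℕ → ℕ → ℝ} {G : ℝ → ℝ} {C β : ℝ}

theorem tendsto_sum_Ico_of_dominated (hβ : -1 < β) (hβ0 : β ≤ 0)
    (hdom : ∀ n k : ℕ, 1 ≤ k → k < n → |F n k| ≤ C * ((k : ℝ) / n) ^ β / n)
    (hlim : ∀ x ∈ Set.Ioo (0 : ℝ) 1,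
      Tendsto (fun n : ℕ => (n : ℝ) * F n ⌊x * (n : ℝ)⌋₊) atTop (𝓝 (G x))) :
    Tendsto (fun n : ℕ => ∑ k ∈ Finset.Ico 1 n, F n k) atTop (𝓝 (∫ x in (0 : ℝ)..1, G x)) := by
  have hC : 0 ≤ C := by
    have h := (abs_nonneg _).trans (hdom 2 1 le_rfl one_lt_two)
    rw [mul_div_assoc] at h
    exact nonneg_of_mul_nonneg_left h (by positivity)
  have hmem : ∀ᵐ x : ℝ, x ∈ Set.uIoc (0 : ℝ) 1 → x ∈ Set.Ioo (0 : ℝ) 1 := by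
    filter_upwards [Measure.ae_ne volume (1 : ℝ)] with x hne hx
    rw [Set.uIoc_of_le zero_le_one] at hx
    exact ⟨hx.1, hx.2.lt_of_ne hne⟩
  refine Tendsto.congr' ((eventually_ne_atTop 0).mono fun n hn =>
    (sum_Ico_one_eq_integral_comp_floor_mul (F n) hn).symm) ?_
  refine intervalIntegral.tendsto_integral_filter_of_dominated_convergence
    (fun x => C * ((1 / 2) ^ β * x ^ β)) (Eventually.of_forall fun n => ?_)
    ((eventually_gt_atTop 0).mono fun n hn => hmem.mono fun x hx' hx => ?_)
    (((intervalIntegral.intervalIntegrable_rpow' hβ).const_mul _).const_mul _)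
    (hmem.mono fun x hx' hx => ?_)
  · exact ((measurable_from_nat (f := fun k => if k = 0 then 0 else n * F n k)).comp
      (Nat.measurable_floor.comp (measurable_mul_const _))).aestronglyMeasurable
  · obtain ⟨hx0, hx1⟩ := hx' hx
    have hn0 : (0 : ℝ) < n := Nat.cast_pos.2 hn
    split_ifs with hk
    · rw [norm_zero]
      positivity
    have hkn : ⌊x * (n : ℝ)⌋₊ < n :=
      (Nat.floor_lt (by positivity)).2 (mul_lt_of_lt_one_left hn0 hx1)
    rw [Real.norm_eq_abs, abs_mul, Nat.abs_cast]
    calc (n : ℝ) * |F n ⌊x * (n : ℝ)⌋₊|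
        ≤ n * (C * ((⌊x * (n : ℝ)⌋₊ : ℝ) / n) ^ β / n) := by
          gcongr
          exact hdom n _ (Nat.one_le_iff_ne_zero.2 hk) hkn
      _ = C * ((⌊x * (n : ℝ)⌋₊ : ℝ) / n) ^ β := by field_simp
      _ ≤ C * ((1 / 2) ^ β * x ^ β) := by
          gcongr
          exact rpow_floor_mul_div_le hβ0 hx0 hk
  · refine (hlim x (hx' hx)).congr' ?_
    filter_upwards [(tendsto_floor_mul_natCast_atTop (hx' hx).1).eventually_gt_atTop 0] with n hn
    rw [if_neg hn.ne']

theorem tendsto_sum_Icc_of_dominated (hβ : -1 < β) (hβ0 : β ≤ 0)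
    (hdom : ∀ n k : ℕ, 1 ≤ k → k ≤ n → |F n k| ≤ C * ((k : ℝ) / n) ^ β / n)
    (hlim : ∀ x ∈ Set.Ioo (0 : ℝ) 1,
      Tendsto (fun n : ℕ => (n : ℝ) * F n ⌊x * (n : ℝ)⌋₊) atTop (𝓝 (G x))) :
    Tendsto (fun n : ℕ => ∑ k ∈ Finset.Icc 1 n, F n k) atTop (𝓝 (∫ x in (0 : ℝ)..1, G x)) := by
  have hlast : Tendsto (fun n : ℕ => F n n) atTop (𝓝 0) := by
    refine squeeze_zero_norm' ?_ (tendsto_const_div_atTop_nhds_zero_nat C)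
    filter_upwards [eventually_gt_atTop 0] with n hn
    simpa [div_self (Nat.cast_ne_zero.2 hn.ne' : (n : ℝ) ≠ 0)] using hdom n n hn le_rfl
  have hsum := (tendsto_sum_Ico_of_dominated hβ hβ0
    (fun n k hk hkn => hdom n k hk hkn.le) hlim).add hlast
  rw [add_zero] at hsum
  refine hsum.congr' ?_
  filter_upwards [eventually_gt_atTop 0] with n hn
  rw [← Finset.Ico_add_one_right_eq_Icc, Finset.sum_Ico_succ_top (Nat.one_le_of_lt hn)]

theorem abs_log_one_add_le {y c : ℝ} (hc : 0 < c) (hc1 : c ≤ 1) (hy : c ≤ 1 + y) :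
    |Real.log (1 + y)| ≤ c⁻¹ * |y| := by
  have hy0 : 0 < 1 + y := hc.trans_le hy
  have hupper := Real.log_le_sub_one_of_pos hy0
  have hlower : (1 + y)⁻¹ * y ≤ Real.log (1 + y) := by
    refine le_of_eq_of_le ?_ (Real.one_sub_inv_le_log_of_pos hy0)
    field_simp
    ring
  have habs : |(1 + y)⁻¹ * y| ≤ c⁻¹ * |y| := by
    rw [abs_mul, abs_of_pos (inv_pos.2 hy0)]
    gcongr
  have hle : |y| ≤ c⁻¹ * |y| :=
    le_mul_of_one_le_left (abs_nonneg y) ((one_le_inv₀ hc).2 hc1)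
  exact abs_le.2 ⟨(abs_le.1 habs).1.trans hlower, by linarith [le_abs_self y]⟩

theorem tendsto_prod_one_add_of_dominated {c : ℝ} (hβ : -1 < β) (hβ0 : β ≤ 0) (hc : 0 < c)
    (hc1 : c ≤ 1) (hF : ∀ n k : ℕ, 1 ≤ k → k ≤ n → c ≤ 1 + F n k)
    (hdom : ∀ n k : ℕ, 1 ≤ k → k ≤ n → |F n k| ≤ C * ((k : ℝ) / n) ^ β / n)
    (hlim : ∀ x ∈ Set.Ioo (0 : ℝ) 1,
      Tendsto (fun n : ℕ => (n : ℝ) * F n ⌊x * (n : ℝ)⌋₊) atTop (𝓝 (G x))) :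
    Tendsto (fun n : ℕ => ∏ k ∈ Finset.Icc 1 n, (1 + F n k)) atTop
      (𝓝 (Real.exp (∫ x in (0 : ℝ)..1, G x))) := by
  have hlog : Tendsto (fun n : ℕ => ∑ k ∈ Finset.Icc 1 n, Real.log (1 + F n k)) atTop
      (𝓝 (∫ x in (0 : ℝ)..1, G x)) := by
    refine tendsto_sum_Icc_of_dominated (C := c⁻¹ * C) hβ hβ0 (fun n k hk hkn => ?_)
      fun x hx => Real.tendsto_nat_mul_log_one_add_of_tendsto (hlim x hx)
    calc |Real.log (1 + F n k)| ≤ c⁻¹ * |F n k| := abs_log_one_add_le hc hc1 (hF n k hk hkn)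
      _ ≤ c⁻¹ * (C * ((k : ℝ) / n) ^ β / n) := by
          gcongr
          exact hdom n k hk hkn
      _ = c⁻¹ * C * ((k : ℝ) / n) ^ β / n := by ring
  refine ((Real.continuous_exp.tendsto _).comp hlog).congr fun n => ?_
  rw [Function.comp_apply, Real.exp_sum]
  refine Finset.prod_congr rfl fun k hk => Real.exp_log (hc.trans_le ?_)
  exact hF n k (Finset.mem_Icc.1 hk).1 (Finset.mem_Icc.1 hk).2

end RiemannSum

-- Karamata's theorem, by dominated convergence.
theorem RegularlyVarying.tendsto_sum_div {a : ℕ → ℝ} {α : ℝ} (hreg : RegularlyVarying a α)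
    (hα : -1 < α) (ha : ∀ n, 1 ≤ n → 0 < a n) :
    Tendsto (fun n : ℕ => (∑ k ∈ Finset.Icc 1 n, a k) / (n * a n)) atTop (𝓝 (1 / (α + 1))) := by
  have hβ : -1 < min ((α - 1) / 2) 0 := lt_min (by linarith) (by norm_num)
  have hβα : min ((α - 1) / 2) 0 < α := (min_le_left _ _).trans_lt (by linarith)
  obtain ⟨C, -, hCa⟩ := hreg.exists_forall_le_mul_rpow_mul ha hβα
  have hint : ∫ x in (0 : ℝ)..1, x ^ α = 1 / (α + 1) := by
    rw [integral_rpow (Or.inl hα), Real.one_rpow, Real.zero_rpow (by linarith), sub_zero]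
  simp only [Finset.sum_div]
  rw [← hint]
  refine tendsto_sum_Icc_of_dominated (C := C) hβ (min_le_right _ _) (fun n k hk hkn => ?_)
    fun x hx => (hreg x hx.1).congr' ?_
  · have hn0 : (0 : ℝ) < n := Nat.cast_pos.2 (hk.trans hkn)
    have han := ha n (hk.trans hkn)
    rw [abs_of_pos (div_pos (ha k hk) (by positivity)), mul_comm (n : ℝ), ← div_div]
    gcongr
    exact (div_le_iff₀ han).2 (hCa k n hk hkn)
  · filter_upwards [eventually_gt_atTop 0] with n hn
    rw [← mul_div_assoc, mul_div_mul_left _ _ (Nat.cast_ne_zero.2 hn.ne')]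

theorem integral_comp_rpow_div {α : ℝ} (hα : 0 < α) (g : ℝ → ℝ) :
    ∫ x in (0 : ℝ)..1, α * g (x ^ α) / x = ∫ y in (0 : ℝ)..1, g y / y := by
  have hmem {x : ℝ} (hx : 0 < x) : x ^ α ∈ Set.Ioc (0 : ℝ) 1 ↔ x ∈ Set.Ioc (0 : ℝ) 1 := by
    simp only [Set.mem_Ioc, Real.rpow_pos_of_pos hx, hx, true_and]
    rw [← Real.rpow_le_rpow_iff hx.le zero_le_one hα, Real.one_rpow]
  have hset (f : ℝ → ℝ) :
      ∫ x in (0 : ℝ)..1, f x = ∫ x in Set.Ioi 0, (Set.Ioc (0 : ℝ) 1).indicator f x := by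
    rw [setIntegral_indicator measurableSet_Ioc, Set.inter_eq_right.2 Set.Ioc_subset_Ioi_self,
      intervalIntegral.integral_of_le zero_le_one]
  rw [hset, hset]
  refine Eq.trans ?_ (integral_comp_rpow_Ioi_of_pos hα)
  refine setIntegral_congr_fun measurableSet_Ioi fun x (hx : 0 < x) => ?_
  by_cases h : x ∈ Set.Ioc (0 : ℝ) 1
  · simp only [Set.indicator_of_mem h, Set.indicator_of_mem ((hmem hx).2 h), smul_eq_mul]
    rw [Real.rpow_sub_one hx.ne']
    field_simp
  · simp only [Set.indicator_of_notMem h, Set.indicator_of_notMem (mt (hmem hx).1 h), smul_zero]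

theorem intervalIntegrable_div_of_abs_le {f : ℝ → ℝ} {C : ℝ} (hf : Measurable f)
    (hC : ∀ u ∈ Set.Ioc (0 : ℝ) 1, |f u| ≤ C * u) :
    IntervalIntegrable (fun u => f u / u) volume 0 1 := by
  refine (intervalIntegrable_const (c := C)).mono_fun'
    (hf.div measurable_id).aestronglyMeasurable ?_
  refine (ae_restrict_iff' measurableSet_uIoc).2 (ae_of_all _ fun u hu => ?_)
  rw [Set.uIoc_of_le zero_le_one] at hu
  simpa only [Real.norm_eq_abs, abs_div, abs_of_pos hu.1, div_le_iff₀ hu.1] using hC u hu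

theorem abs_exp_sub_one_le_mul_exp (x : ℝ) : |Real.exp x - 1| ≤ |x| * Real.exp |x| := by
  have h := Complex.norm_exp_sub_sum_le_norm_mul_exp x 1
  rw [Finset.sum_range_one, pow_zero, Nat.factorial_zero, Nat.cast_one, div_one, pow_one,
    Complex.norm_real, ← Complex.ofReal_exp] at h
  exact_mod_cast h

namespace LineBreaking

/-- `E[exp (s V)] - 1` for `V` uniform on `(0, 1)`: the first-order effect on the Laplace transform
of a height when one grafts a uniform point of a segment. -/
noncomputable def expMean (s : ℝ) : ℝ := ∫ v in (0 : ℝ)..1, (Real.exp (s * v) - 1)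

theorem abs_mul_le_abs_of_mem_Icc (s : ℝ) {v : ℝ} (hv : v ∈ Set.Icc (0 : ℝ) 1) : |s * v| ≤ |s| := by
  rw [abs_mul, abs_of_nonneg hv.1]
  exact mul_le_of_le_one_right (abs_nonneg s) hv.2

theorem abs_expMean_le (s : ℝ) : |expMean s| ≤ |s| * Real.exp |s| := by
  have h := intervalIntegral.norm_integral_le_of_norm_le_const (a := (0 : ℝ)) (b := 1)
    (f := fun v => Real.exp (s * v) - 1) (C := |s| * Real.exp |s|) fun v hv => by
      rw [Set.uIoc_of_le zero_le_one] at hv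
      have hsv := abs_mul_le_abs_of_mem_Icc s ⟨hv.1.le, hv.2⟩
      refine (abs_exp_sub_one_le_mul_exp _).trans ?_
      gcongr
  simpa [expMean] using h

theorem exp_neg_abs_le_one_add_mul_expMean {p : ℝ} (hp : p ∈ Set.Icc (0 : ℝ) 1) (s : ℝ) :
    Real.exp (-|s|) ≤ 1 + p * expMean s := by
  have hmean : ∫ _ in (0 : ℝ)..1, (Real.exp (-|s|) - 1) ≤ expMean s := by
    refine intervalIntegral.integral_mono_on zero_le_one intervalIntegrable_const
      (Continuous.intervalIntegrable (by fun_prop) _ _) fun v hv => ?_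
    gcongr
    linarith [neg_abs_le (s * v), abs_mul_le_abs_of_mem_Icc s hv]
  rw [intervalIntegral.integral_const, sub_zero, one_smul] at hmean
  have hone : Real.exp (-|s|) ≤ 1 := Real.exp_le_one_iff.2 (neg_nonpos.2 (abs_nonneg s))
  nlinarith [hp.1, hp.2]

theorem mul_expMean (t y : ℝ) :
    y * expMean (t * y) = ∫ u in (0 : ℝ)..y, (Real.exp (t * u) - 1) := by
  simpa [expMean, mul_assoc] using intervalIntegral.mul_integral_comp_mul_left (a := 0) (b := 1)
    (f := fun u => Real.exp (t * u) - 1) y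

theorem integral_exp_mul (t b : ℝ) :
    ∫ s in (0 : ℝ)..b, Real.exp (t * s) = b * (1 + expMean (t * b)) := by
  rw [mul_add, mul_expMean, intervalIntegral.integral_sub
    (Continuous.intervalIntegrable (by fun_prop) _ _) intervalIntegrable_const]
  simp

theorem hasDerivAt_expMean_mul (t : ℝ) {y : ℝ} (hy : y ≠ 0) :
    HasDerivAt (fun y => expMean (t * y)) ((Real.exp (t * y) - 1 - expMean (t * y)) / y) y := by
  have hprim : HasDerivAt (fun y => ∫ u in (0 : ℝ)..y, (Real.exp (t * u) - 1))
      (Real.exp (t * y) - 1) y :=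
    (Continuous.integral_hasStrictDerivAt (by fun_prop) 0 y).hasDerivAt
  have heq : (fun y => (∫ u in (0 : ℝ)..y, (Real.exp (t * u) - 1)) / id y) =ᶠ[𝓝 y]
      fun y => expMean (t * y) := by
    filter_upwards [isOpen_ne.mem_nhds hy] with z hz
    rw [← mul_expMean, id, mul_div_cancel_left₀ _ hz]
  refine ((hprim.div (hasDerivAt_id y) hy).congr_of_eventuallyEq heq.symm).congr_deriv ?_
  rw [← mul_expMean, id]
  field_simp

theorem continuous_expMean : Continuous expMean :=
  intervalIntegral.continuous_parametric_intervalIntegral_of_continuous' (by fun_prop) _ _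

theorem expMean_zero : expMean 0 = 0 := by simp [expMean]

theorem integral_expMean_mul_div (t : ℝ) :
    ∫ y in (0 : ℝ)..1, expMean (t * y) / y =
      ∫ u in (0 : ℝ)..1, (Real.exp (t * u) - 1) * ((1 - u) / u) := by
  have hle {b u : ℝ} (hu : u ∈ Set.Ioc (0 : ℝ) 1) (hb : |b| ≤ |t * u| * Real.exp |t * u|) :
      |b| ≤ |t| * Real.exp |t| * u := by
    have htu := abs_mul_le_abs_of_mem_Icc t ⟨hu.1.le, hu.2⟩
    calc |b| ≤ |t * u| * Real.exp |t| := hb.trans (by gcongr)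
      _ = |t| * Real.exp |t| * u := by rw [abs_mul, abs_of_pos hu.1]; ring
  have hexp : IntervalIntegrable (fun u => (Real.exp (t * u) - 1) / u) volume 0 1 :=
    intervalIntegrable_div_of_abs_le (by fun_prop) fun u hu => hle hu (abs_exp_sub_one_le_mul_exp _)
  have hcont : Continuous fun y => expMean (t * y) := continuous_expMean.comp (by fun_prop)
  have hmean : IntervalIntegrable (fun u => expMean (t * u) / u) volume 0 1 :=
    intervalIntegrable_div_of_abs_le hcont.measurable fun u hu => hle hu (abs_expMean_le _)
  have hftc : (∫ u in (0 : ℝ)..1, (Real.exp (t * u) - 1) / u) -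
      ∫ u in (0 : ℝ)..1, expMean (t * u) / u = expMean t := by
    rw [← intervalIntegral.integral_sub hexp hmean]
    simp only [← sub_div]
    rw [intervalIntegral.integral_eq_sub_of_hasDerivAt_of_le zero_le_one hcont.continuousOn
      (fun y hy => hasDerivAt_expMean_mul t hy.1.ne')
      (by simpa only [sub_div] using hexp.sub hmean),
      mul_one, mul_zero, expMean_zero, sub_zero]
  have hsub : ∫ y in (0 : ℝ)..1, expMean (t * y) / y =
      (∫ u in (0 : ℝ)..1, (Real.exp (t * u) - 1) / u) - expMean t := by
    rw [← hftc, sub_sub_cancel]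
  rw [hsub, expMean, ← intervalIntegral.integral_sub
    hexp (Continuous.intervalIntegrable (by fun_prop) _ _)]
  refine intervalIntegral.integral_congr_ae (ae_of_all _ fun u hu => ?_)
  rw [Set.uIoc_of_le zero_le_one] at hu
  have hu0 := hu.1.ne'
  field_simp

theorem phi_eq_integral_expMean {α : ℝ} (hα : 0 < α) (t : ℝ) :
    phi α t = ∫ x in (0 : ℝ)..1, (α + 1) / x * expMean (t * x ^ α) := by
  rw [phi, ← integral_expMean_mul_div,
    ← integral_comp_rpow_div hα fun y => expMean (t * y), ← intervalIntegral.integral_const_mul]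
  refine intervalIntegral.integral_congr fun x _ => ?_
  field_simp

/-- The total length of the tree `T_n`. -/
def totalLength (a : ℕ → ℝ) (n : ℕ) : ℝ := ∑ k ∈ Finset.Icc 1 n, a k

section TotalLength

variable {a : ℕ → ℝ}

theorem totalLength_succ (a : ℕ → ℝ) (n : ℕ) :
    totalLength a (n + 1) = totalLength a n + a (n + 1) :=
  Finset.sum_Icc_succ_top (Nat.le_add_left 1 n) a

variable (ha : ∀ n, 1 ≤ n → 0 < a n)
include ha

theorem le_totalLength {n : ℕ} (hn : 1 ≤ n) : a n ≤ totalLength a n :=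
  Finset.single_le_sum (f := a) (fun k hk => (ha k (Finset.mem_Icc.1 hk).1).le)
    (Finset.mem_Icc.2 ⟨hn, le_rfl⟩)

theorem totalLength_pos {n : ℕ} (hn : 1 ≤ n) : 0 < totalLength a n :=
  (ha n hn).trans_le (le_totalLength ha hn)

theorem div_totalLength_mem_Icc {n : ℕ} (hn : 1 ≤ n) :
    a n / totalLength a n ∈ Set.Icc (0 : ℝ) 1 :=
  ⟨(div_pos (ha n hn) (totalLength_pos ha hn)).le,
    (div_le_one (totalLength_pos ha hn)).2 (le_totalLength ha hn)⟩

theorem tendsto_mul_div_totalLength {α : ℝ} (hreg : RegularlyVarying a α) (hα : -1 < α) :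
    Tendsto (fun n : ℕ => (n : ℝ) * (a n / totalLength a n)) atTop (𝓝 (α + 1)) := by
  have h := (hreg.tendsto_sum_div hα ha).inv₀ (one_div_pos.2 (by linarith)).ne'
  simp only [one_div, inv_inv, inv_div, mul_div_assoc] at h
  exact h

theorem tendsto_floor_mul_div_totalLength_mul_expMean {α : ℝ} (hreg : RegularlyVarying a α)
    (hα : -1 < α) (t : ℝ) {x : ℝ} (hx : 0 < x) :
    Tendsto (fun n : ℕ => (n : ℝ) * (a ⌊x * (n : ℝ)⌋₊ / totalLength a ⌊x * (n : ℝ)⌋₊ *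
      expMean (t * (a ⌊x * (n : ℝ)⌋₊ / a n)))) atTop
      (𝓝 ((α + 1) / x * expMean (t * x ^ α))) := by
  have hfloor := tendsto_floor_mul_natCast_atTop hx
  have hratio := (tendsto_floor_mul_natCast_div hx.le).inv₀ hx.ne'
  have hmean := (continuous_expMean.tendsto _).comp ((hreg x hx).const_mul t)
  have hlim := (((tendsto_mul_div_totalLength ha hreg hα).comp hfloor).mul hratio).mul hmean
  rw [← div_eq_mul_inv] at hlim
  refine hlim.congr' ?_
  filter_upwards [hfloor.eventually_gt_atTop 0] with n hn
  have hn0 : (⌊x * (n : ℝ)⌋₊ : ℝ) ≠ 0 := Nat.cast_ne_zero.2 hn.ne'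
  simp only [Function.comp_apply, inv_div]
  field_simp

theorem exists_forall_abs_mul_div_le {α β : ℝ} (hreg : RegularlyVarying a α) (hβα : β < α)
    (t : ℝ) :
    ∃ S, 0 ≤ S ∧ ∀ n k : ℕ, 1 ≤ k → k ≤ n → |t * (a k / a n)| ≤ S * ((k : ℝ) / n) ^ β := by
  obtain ⟨C, hC, hCa⟩ := hreg.exists_forall_le_mul_rpow_mul ha hβα
  refine ⟨|t| * C, by positivity, fun n k hk hkn => ?_⟩
  have han := ha n (hk.trans hkn)
  rw [abs_mul, abs_of_pos (div_pos (ha k hk) han), mul_assoc]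
  gcongr
  exact (div_le_iff₀ han).2 (hCa k n hk hkn)

theorem tendsto_prod_one_add_mul_expMean {α : ℝ} (hreg : RegularlyVarying a α) (hα : 0 < α)
    (t : ℝ) :
    Tendsto (fun n : ℕ => ∏ k ∈ Finset.Icc 1 n,
      (1 + a k / totalLength a k * expMean (t * (a k / a n)))) atTop
      (𝓝 (Real.exp (phi α t))) := by
  obtain ⟨β, hβ, hβmin⟩ := exists_between (lt_min hα one_pos)
  obtain ⟨hβα, hβ1⟩ := lt_min_iff.1 hβmin
  obtain ⟨S, hS0, hS⟩ := exists_forall_abs_mul_div_le ha hreg hβα t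
  obtain ⟨D, hD⟩ := (tendsto_mul_div_totalLength ha hreg (by linarith)).bddAbove_range
  have hD (k : ℕ) : (k : ℝ) * (a k / totalLength a k) ≤ D := hD ⟨k, rfl⟩
  have hD0 : 0 ≤ D := by simpa using hD 0
  have hS' {n k : ℕ} (hk : 1 ≤ k) (hkn : k ≤ n) : |t * (a k / a n)| ≤ S := by
    refine (hS n k hk hkn).trans (mul_le_of_le_one_right hS0 ?_)
    exact Real.rpow_le_one (by positivity)
      (div_le_one_of_le₀ (Nat.cast_le.2 hkn) n.cast_nonneg) hβ.le
  rw [phi_eq_integral_expMean hα]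
  refine tendsto_prod_one_add_of_dominated (C := D * (S * Real.exp S)) (β := β - 1)
    (c := Real.exp (-S)) (by linarith) (by linarith) (Real.exp_pos _)
    (Real.exp_le_one_iff.2 (neg_nonpos.2 hS0)) (fun n k hk hkn => ?_)
    (fun n k hk hkn => ?_)
    fun x hx => tendsto_floor_mul_div_totalLength_mul_expMean ha hreg (by linarith) t hx.1
  · exact (Real.exp_le_exp.2 (neg_le_neg (hS' hk hkn))).trans
      (exp_neg_abs_le_one_add_mul_expMean (div_totalLength_mem_Icc ha hk) _)
  · have hk0 : (0 : ℝ) < k := Nat.cast_pos.2 hk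
    have hn0 : (0 : ℝ) < n := Nat.cast_pos.2 (hk.trans hkn)
    calc |a k / totalLength a k * expMean (t * (a k / a n))|
        ≤ D / k * (S * ((k : ℝ) / n) ^ β * Real.exp S) := by
          rw [abs_mul, abs_of_nonneg (div_totalLength_mem_Icc ha hk).1]
          refine mul_le_mul ((le_div_iff₀' hk0).2 (hD k)) ((abs_expMean_le _).trans ?_)
            (abs_nonneg _) (by positivity)
          gcongr
          exacts [hS n k hk hkn, hS' hk hkn]
      _ = D * (S * Real.exp S) * ((k : ℝ) / n) ^ (β - 1) / n := by
          rw [Real.rpow_sub_one (by positivity)]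
          field_simp

end TotalLength

end LineBreaking

section Independence

variable {Ω β γ : Type*} [MeasurableSpace Ω] [MeasurableSpace β] [MeasurableSpace γ]
  {P : Measure Ω} {Y : Ω → β} {Z : Ω → γ}

theorem integral_map_of_isUniform_finset [MeasurableSingletonClass β] {s : Finset β}
    (hY : pdf.IsUniform Y s P Measure.count) (f : β → ℝ) :
    ∫ y, f y ∂(P.map Y) = ∑ y ∈ s, f y / s.card := by
  have hint : IntegrableOn f s Measure.count := by
    rw [← Set.biUnion_of_singleton (s : Set β)]
    simp [integrableOn_finset_iUnion]
  rw [hY, ProbabilityTheory.cond, integral_smul_measure, setIntegral_finset _ hint,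
    Measure.count_apply_finset, Finset.smul_sum]
  refine Finset.sum_congr rfl fun y _ => ?_
  simp [measureReal_def, div_eq_inv_mul]

variable [IsFiniteMeasure P]

theorem lintegral_comp_prodMk_of_indepFun (hYZ : IndepFun Y Z P) (hY : Measurable Y)
    (hZ : Measurable Z) {F : β × γ → ENNReal} (hF : Measurable F) :
    ∫⁻ ω, F (Y ω, Z ω) ∂P = ∫⁻ y, ∫⁻ ω, F (y, Z ω) ∂P ∂(P.map Y) := by
  rw [← lintegral_map hF (hY.prodMk hZ),
    (indepFun_iff_map_prod_eq_prod_map_map hY.aemeasurable hZ.aemeasurable).1 hYZ,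
    lintegral_prod _ hF.aemeasurable]
  exact lintegral_congr fun y => lintegral_map (hF.comp measurable_prodMk_left) hZ

theorem integral_comp_prodMk_of_indepFun (hYZ : IndepFun Y Z P) (hY : Measurable Y)
    (hZ : Measurable Z) {F : β × γ → ℝ} (hF : Measurable F) {C : ℝ} (hC : ∀ x, |F x| ≤ C) :
    ∫ ω, F (Y ω, Z ω) ∂P = ∫ y, ∫ ω, F (y, Z ω) ∂P ∂(P.map Y) := by
  rw [← integral_map (hY.prodMk hZ).aemeasurable hF.aestronglyMeasurable,
    (indepFun_iff_map_prod_eq_prod_map_map hY.aemeasurable hZ.aemeasurable).1 hYZ,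
    integral_prod _ (Integrable.of_bound hF.aestronglyMeasurable C (ae_of_all _ hC))]
  exact integral_congr_ae (ae_of_all _ fun y =>
    integral_map hZ.aemeasurable (hF.comp measurable_prodMk_left).aestronglyMeasurable)

theorem integral_comp_prodMk_of_isUniform_Ioo {U : Ω → ℝ} (hU : Measurable U) (hZ : Measurable Z)
    (hunif : pdf.IsUniform U (Set.Ioo 0 1) P volume) (hind : IndepFun U Z P)
    {F : ℝ × γ → ℝ} (hF : Measurable F) {C : ℝ} (hC : ∀ x, |F x| ≤ C) :
    ∫ ω, F (U ω, Z ω) ∂P = ∫ x in (0 : ℝ)..1, ∫ ω, F (x, Z ω) ∂P := by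
  rw [integral_comp_prodMk_of_indepFun hind hU hZ hF hC, hunif, ProbabilityTheory.cond,
    intervalIntegral.integral_of_le zero_le_one, integral_Ioc_eq_integral_Ioo]
  simp

end Independence

namespace LineBreaking

section Height

/-- The distance from the point `p` of `T_n` to the root, for the gluing points `g`. -/
noncomputable def height (g : ℕ → ℕ × ℝ) (n : ℕ) (p : ℕ × ℝ) : ℝ := treeDist g n p root

/-- The distance from the point `p` of `T_n` to the root, as a function of the gluing points
`v 1, …, v (n - 1)` which determine `T_n`. -/
noncomputable def heightOn (n : ℕ) (v : Finset.Ico 1 n → ℕ × ℝ) (p : ℕ × ℝ) : ℝ :=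
  height (Function.extend Subtype.val v 0) n p

theorem height_one (g : ℕ → ℕ × ℝ) (p : ℕ × ℝ) :
    height g 1 p = if p.1 ≤ 0 then 0 else |p.2| := by
  simp [height, treeDist, root]

theorem height_succ (g : ℕ → ℕ × ℝ) {n : ℕ} (hn : 1 ≤ n) (p : ℕ × ℝ) :
    height g (n + 1) p = if p.1 ≤ n then height g n p else p.2 + height g n (g n) := by
  simp [height, treeDist, root, hn]

theorem height_of_le (g : ℕ → ℕ × ℝ) {m n : ℕ} {p : ℕ × ℝ} (hm : 1 ≤ m) (hp : p.1 ≤ m)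
    (hmn : m ≤ n) : height g n p = height g m p := by
  induction n, hmn using Nat.le_induction with
  | base => rfl
  | succ n hmn ih => rw [height_succ g (hm.trans hmn), if_pos (hp.trans hmn), ih]

theorem height_succ_mk (g : ℕ → ℕ × ℝ) (n : ℕ) {s : ℝ} (hs : 0 ≤ s) :
    height g (n + 1) (n + 1, s) = s + height g n (g n) := by
  rcases Nat.eq_zero_or_pos n with rfl | hn
  · simp [height, treeDist, root, abs_of_nonneg hs]
  · simp [height_succ g hn]

theorem height_congr {g g' : ℕ → ℕ × ℝ} {n : ℕ} (h : ∀ k ∈ Finset.Ico 1 n, g k = g' k)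
    (p : ℕ × ℝ) : height g n p = height g' n p := by
  induction n generalizing p with
  | zero => rfl
  | succ n ih =>
    rcases Nat.eq_zero_or_pos n with rfl | hn
    · simp only [zero_add, height_one]
    · have ih := ih fun k hk => h k (Finset.Ico_subset_Ico_right n.le_succ hk)
      simp only [height_succ _ hn, ih, h n (Finset.mem_Ico.2 ⟨hn, n.lt_succ_self⟩)]

theorem measurable_height (n : ℕ) :
    Measurable fun x : (ℕ → ℕ × ℝ) × (ℕ × ℝ) => height x.1 n x.2 := by
  induction n with
  | zero => exact measurable_const
  | succ n ih =>
    have hle : MeasurableSet {x : (ℕ → ℕ × ℝ) × (ℕ × ℝ) | x.2.1 ≤ n} :=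
      measurableSet_le (by fun_prop) measurable_const
    rcases Nat.eq_zero_or_pos n with rfl | hn
    · simp only [zero_add, height_one]
      exact measurable_const.ite hle (by fun_prop)
    · simp only [height_succ _ hn]
      have hglued : Measurable fun x : (ℕ → ℕ × ℝ) × (ℕ × ℝ) => height x.1 n (x.1 n) :=
        ih.comp (measurable_fst.prodMk ((measurable_pi_apply n).comp measurable_fst))
      exact ih.ite hle (by fun_prop)

theorem heightOn_restrict {Ω : Type*} (X : ℕ → Ω → ℕ × ℝ) (n : ℕ) (ω : Ω) (p : ℕ × ℝ) :
    heightOn n (fun k => X k ω) p = height (fun k => X k ω) n p :=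
  height_congr (fun k hk => Subtype.val_injective.extend_apply _ _ (⟨k, hk⟩ : Finset.Ico 1 n)) p

theorem measurable_heightOn (n : ℕ) :
    Measurable fun x : (ℕ × ℝ) × (Finset.Ico 1 n → ℕ × ℝ) => heightOn n x.2 x.1 := by
  have hext : Measurable fun v : Finset.Ico 1 n → ℕ × ℝ =>
      Function.extend (Subtype.val : Finset.Ico 1 n → ℕ) v 0 := by
    refine measurable_pi_lambda _ fun k => ?_
    by_cases hk : k ∈ Finset.Ico 1 n
    · simpa only [Subtype.val_injective.extend_apply _ _ (⟨k, hk⟩ : Finset.Ico 1 n)] using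
        measurable_pi_apply _
    · have hnot : ¬ ∃ j : Finset.Ico 1 n, (j : ℕ) = k := fun ⟨j, hj⟩ => hk (hj ▸ j.2)
      simp only [Function.extend_apply' _ _ _ hnot, measurable_const]
  exact (measurable_height n).comp ((hext.comp measurable_snd).prodMk measurable_fst)

end Height

section LengthMeasure

theorem measurableSet_tree (a : ℕ → ℝ) (n : ℕ) : MeasurableSet (tree a n) := by
  have ha : Measurable fun p : ℕ × ℝ => a p.1 := (measurable_from_nat (f := a)).comp measurable_fst
  exact (measurableSet_le measurable_const measurable_fst).inter
    ((measurableSet_le measurable_fst measurable_const).inter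
      ((measurableSet_le measurable_const measurable_snd).inter
        (measurableSet_le measurable_snd ha)))

theorem setLIntegral_tree (a : ℕ → ℝ) (n : ℕ) {f : ℕ × ℝ → ENNReal} (hf : Measurable f) :
    ∫⁻ p in tree a n, f p ∂lengthMeasure =
      ∑ k ∈ Finset.Icc 1 n, ∫⁻ s in Set.Icc 0 (a k), f (k, s) := by
  have hind : Measurable ((tree a n).indicator f) := hf.indicator (measurableSet_tree a n)
  rw [← lintegral_indicator (measurableSet_tree a n), lengthMeasure,
    lintegral_prod _ hind.aemeasurable, lintegral_count, tsum_eq_sum (s := Finset.Icc 1 n)]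
  · refine Finset.sum_congr rfl fun k hk => ?_
    rw [← lintegral_indicator measurableSet_Icc]
    refine lintegral_congr fun s => ?_
    simp [Set.indicator, tree, Finset.mem_Icc.1 hk]
  · intro k hk
    have hout (s : ℝ) : (k, s) ∉ tree a n := fun h => hk (Finset.mem_Icc.2 ⟨h.1, h.2.1⟩)
    simp [hout]

theorem lengthMeasure_tree {a : ℕ → ℝ} (ha : ∀ n, 1 ≤ n → 0 < a n) (n : ℕ) :
    lengthMeasure (tree a n) = ENNReal.ofReal (totalLength a n) := by
  rw [← setLIntegral_one, setLIntegral_tree a n measurable_const, totalLength,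
    ENNReal.ofReal_sum_of_nonneg fun k hk => (ha k (Finset.mem_Icc.1 hk).1).le]
  simp

end LengthMeasure

/-- The distance to the root of the point `X n` of `T_n` on which the segment `b_{n+1}` is
glued. It vanishes for `n = 0`, so that the recursions below start from the empty tree. -/
noncomputable def gluingHeight {Ω : Type*} (X : ℕ → Ω → ℕ × ℝ) (n : ℕ) (ω : Ω) : ℝ :=
  height (fun k => X k ω) n (X n ω)

namespace IsGluing

variable {Ω : Type*} [MeasurableSpace Ω] {P : Measure Ω} {a : ℕ → ℝ} {X : ℕ → Ω → ℕ × ℝ}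

theorem measurable_restrict (hX : IsGluing P a X) (n : ℕ) :
    Measurable fun ω (k : Finset.Ico 1 n) => X k ω :=
  measurable_pi_lambda _ fun k => hX.measurable k (Finset.mem_Ico.1 k.2).1

theorem measurable_height (hX : IsGluing P a X) (n : ℕ) {Y : Ω → ℕ × ℝ} (hY : Measurable Y) :
    Measurable fun ω => height (fun k => X k ω) n (Y ω) := by
  simpa only [Function.comp_def, heightOn_restrict X] using
    (measurable_heightOn n).comp (hY.prodMk (hX.measurable_restrict n))

theorem measurable_gluingHeight (hX : IsGluing P a X) (n : ℕ) :
    Measurable (gluingHeight X n) := by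
  rcases Nat.eq_zero_or_pos n with rfl | hn
  · exact measurable_const
  · exact hX.measurable_height n (hX.measurable n hn)

theorem indepFun_restrict (hX : IsGluing P a X) {n : ℕ} (hn : 1 ≤ n) :
    IndepFun (X n) (fun ω (k : Finset.Ico 1 n) => X k ω) P := by
  obtain ⟨m, rfl⟩ : ∃ m, n = m + 1 := ⟨n - 1, by omega⟩
  have hpred (k : Finset.Ico 1 (m + 1)) : (k : ℕ) - 1 ∈ Finset.range m := by
    have := Finset.mem_Ico.1 k.2
    exact Finset.mem_range.2 (by omega)
  have hindep := (hX.indep.indepFun_finset {m} (Finset.range m) (by simp)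
    fun i => hX.measurable (i + 1) i.succ_pos).comp
    (measurable_pi_apply ⟨m, Finset.mem_singleton_self m⟩)
    (measurable_pi_lambda (fun v (k : Finset.Ico 1 (m + 1)) => v ⟨(k : ℕ) - 1, hpred k⟩)
      fun k => measurable_pi_apply _)
  convert! hindep using 4 with ω k
  exact congrArg (X · ω) (Nat.sub_add_cancel (Finset.mem_Ico.1 k.2).1).symm

variable [IsProbabilityMeasure P]

theorem lintegral_gluingHeight (hX : IsGluing P a X) (ha : ∀ n, 1 ≤ n → 0 < a n) (n : ℕ)
    {f : ℝ → ENNReal} (hf : Measurable f) :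
    ENNReal.ofReal (totalLength a n) * ∫⁻ ω, f (gluingHeight X n ω) ∂P =
      ∑ k ∈ Finset.Icc 1 n, ∫⁻ s in Set.Icc 0 (a k),
        ∫⁻ ω, f (height (fun k => X k ω) n (k, s)) ∂P := by
  rcases Nat.eq_zero_or_pos n with rfl | hn
  · simp [totalLength]
  have hF : Measurable fun x : (ℕ × ℝ) × (Finset.Ico 1 n → ℕ × ℝ) => f (heightOn n x.2 x.1) :=
    hf.comp (measurable_heightOn n)
  have hmean : Measurable fun p => ∫⁻ ω, f (height (fun k => X k ω) n p) ∂P := by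
    simp only [← heightOn_restrict X]
    exact (hF.comp (measurable_fst.prodMk
      ((hX.measurable_restrict n).comp measurable_snd))).lintegral_prod_right'
  have hindep : ∫⁻ ω, f (gluingHeight X n ω) ∂P =
      ∫⁻ p, ∫⁻ ω, f (height (fun k => X k ω) n p) ∂P ∂(P.map (X n)) := by
    simpa only [heightOn_restrict X, gluingHeight] using
      lintegral_comp_prodMk_of_indepFun (hX.indepFun_restrict hn) (hX.measurable n hn)
        (hX.measurable_restrict n) hF
  have hlength : ENNReal.ofReal (totalLength a n) ≠ 0 := by
    simpa using totalLength_pos ha hn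
  rw [hindep, hX.uniform n hn, ProbabilityTheory.cond, lintegral_smul_measure,
    lengthMeasure_tree ha, smul_eq_mul, ← mul_assoc,
    ENNReal.mul_inv_cancel hlength ENNReal.ofReal_ne_top, one_mul, setLIntegral_tree a n hmean]

-- A uniform point of `T_{n+1}` is either a uniform point of `T_n`, or lies on `b_{n+1}`.
theorem lintegral_gluingHeight_succ (hX : IsGluing P a X) (ha : ∀ n, 1 ≤ n → 0 < a n) (n : ℕ)
    {f : ℝ → ENNReal} (hf : Measurable f) :
    ENNReal.ofReal (totalLength a (n + 1)) * ∫⁻ ω, f (gluingHeight X (n + 1) ω) ∂P =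
      ENNReal.ofReal (totalLength a n) * ∫⁻ ω, f (gluingHeight X n ω) ∂P +
        ∫⁻ s in Set.Icc 0 (a (n + 1)), ∫⁻ ω, f (s + gluingHeight X n ω) ∂P := by
  rw [hX.lintegral_gluingHeight ha _ hf, hX.lintegral_gluingHeight ha _ hf,
    Finset.sum_Icc_succ_top (Nat.le_add_left 1 n)]
  congr 1
  · refine Finset.sum_congr rfl fun k hk => ?_
    obtain ⟨hk1, hkn⟩ := Finset.mem_Icc.1 hk
    simp only [height_of_le _ (p := (k, _)) (hk1.trans hkn) hkn n.le_succ]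
  · refine setLIntegral_congr_fun measurableSet_Icc fun s hs => ?_
    simp only [height_succ_mk _ n hs.1, gluingHeight]

theorem lintegral_exp_gluingHeight_succ (hX : IsGluing P a X) (ha : ∀ n, 1 ≤ n → 0 < a n) (t : ℝ)
    (n : ℕ) :
    ENNReal.ofReal (totalLength a (n + 1)) *
        ∫⁻ ω, ENNReal.ofReal (Real.exp (t * gluingHeight X (n + 1) ω)) ∂P =
      (ENNReal.ofReal (totalLength a n) +
        ENNReal.ofReal (a (n + 1) * (1 + expMean (t * a (n + 1))))) *
        ∫⁻ ω, ENNReal.ofReal (Real.exp (t * gluingHeight X n ω)) ∂P := by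
  have hf : Measurable fun x : ℝ => ENNReal.ofReal (Real.exp (t * x)) := by fun_prop
  have hsegment : ∫⁻ s in Set.Icc 0 (a (n + 1)), ENNReal.ofReal (Real.exp (t * s)) =
      ENNReal.ofReal (a (n + 1) * (1 + expMean (t * a (n + 1)))) := by
    rw [← integral_exp_mul, intervalIntegral.integral_of_le (ha _ n.succ_pos).le,
      ← integral_Icc_eq_integral_Ioc, ofReal_integral_eq_lintegral_ofReal
        (Continuous.continuousOn (by fun_prop)).integrableOn_Icc
        (ae_of_all _ fun s => (Real.exp_pos _).le)]
  rw [hX.lintegral_gluingHeight_succ ha n hf, add_mul, ← hsegment, ← lintegral_mul_const _ hf]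
  congr 1
  refine lintegral_congr fun s => ?_
  simp only [mul_add, Real.exp_add, ENNReal.ofReal_mul (Real.exp_pos _).le]
  exact lintegral_const_mul _ (hf.comp (hX.measurable_gluingHeight n))

theorem lintegral_exp_gluingHeight (hX : IsGluing P a X) (ha : ∀ n, 1 ≤ n → 0 < a n) (t : ℝ)
    (n : ℕ) :
    ∫⁻ ω, ENNReal.ofReal (Real.exp (t * gluingHeight X n ω)) ∂P =
      ENNReal.ofReal (∏ k ∈ Finset.Icc 1 n, (1 + a k / totalLength a k * expMean (t * a k))) := by
  induction n with
  | zero => simp [gluingHeight, height, treeDist]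
  | succ n ih =>
    have hlength := totalLength_pos ha n.succ_pos
    have hnonneg : 0 ≤ totalLength a n :=
      Finset.sum_nonneg fun k hk => (ha k (Finset.mem_Icc.1 hk).1).le
    have hsegment : 0 ≤ a (n + 1) * (1 + expMean (t * a (n + 1))) := by
      rw [← integral_exp_mul]
      exact intervalIntegral.integral_nonneg (ha _ n.succ_pos).le fun s _ => (Real.exp_pos _).le
    have hfactor : totalLength a n + a (n + 1) * (1 + expMean (t * a (n + 1))) =
        totalLength a (n + 1) *
          (1 + a (n + 1) / totalLength a (n + 1) * expMean (t * a (n + 1))) := by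
      field_simp
      rw [totalLength_succ]
      ring
    have hfactor0 : 0 ≤ 1 + a (n + 1) / totalLength a (n + 1) * expMean (t * a (n + 1)) :=
      (Real.exp_pos _).le.trans
        (exp_neg_abs_le_one_add_mul_expMean (div_totalLength_mem_Icc ha n.succ_pos) _)
    have hrec := hX.lintegral_exp_gluingHeight_succ ha t n
    rw [ih, ← ENNReal.ofReal_add hnonneg hsegment, hfactor, ENNReal.ofReal_mul hlength.le,
      mul_assoc, ENNReal.mul_right_inj (by simpa using hlength) ENNReal.ofReal_ne_top] at hrec
    rw [hrec, ← ENNReal.ofReal_mul hfactor0, Finset.prod_Icc_succ_top (Nat.le_add_left 1 n),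
      mul_comm]

theorem integrable_exp_mul_gluingHeight (hX : IsGluing P a X) (ha : ∀ n, 1 ≤ n → 0 < a n) (t : ℝ)
    (n : ℕ) : Integrable (fun ω => Real.exp (t * gluingHeight X n ω)) P := by
  refine ⟨(Real.measurable_exp.comp
    ((hX.measurable_gluingHeight n).const_mul t)).aestronglyMeasurable, ?_⟩
  rw [hasFiniteIntegral_iff_ofReal (ae_of_all _ fun ω => (Real.exp_pos _).le),
    hX.lintegral_exp_gluingHeight ha]
  exact ENNReal.ofReal_lt_top

theorem mgf_gluingHeight (hX : IsGluing P a X) (ha : ∀ n, 1 ≤ n → 0 < a n) (t : ℝ) (n : ℕ) :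
    mgf (gluingHeight X n) P t =
      ∏ k ∈ Finset.Icc 1 n, (1 + a k / totalLength a k * expMean (t * a k)) := by
  rw [mgf, integral_eq_lintegral_of_nonneg_ae (ae_of_all _ fun ω => (Real.exp_pos _).le)
    (hX.integrable_exp_mul_gluingHeight ha t n).1, hX.lintegral_exp_gluingHeight ha,
    ENNReal.toReal_ofReal]
  exact Finset.prod_nonneg fun k hk => (Real.exp_pos _).le.trans
    (exp_neg_abs_le_one_add_mul_expMean (div_totalLength_mem_Icc ha (Finset.mem_Icc.1 hk).1) _)

theorem tendsto_mgf_gluingHeight_div (hX : IsGluing P a X) (ha : ∀ n, 1 ≤ n → 0 < a n) {α : ℝ}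
    (hreg : RegularlyVarying a α) (hα : 0 < α) (t : ℝ) :
    Tendsto (fun n => mgf (fun ω => gluingHeight X n ω / a (n + 1)) P t) atTop
      (𝓝 (Real.exp (phi α t))) := by
  have hlast : Tendsto (fun n => 1 + a n / totalLength a n * expMean (t * (a n / a n))) atTop
      (𝓝 1) := by
    have hratio := (tendsto_mul_div_totalLength ha hreg (by linarith)).mul
      tendsto_one_div_atTop_nhds_zero_nat
    have hlim := (hratio.mul_const (expMean t)).const_add 1
    rw [mul_zero, zero_mul, add_zero] at hlim
    refine hlim.congr' ?_
    filter_upwards [eventually_gt_atTop 0] with n hn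
    have hn0 : (n : ℝ) ≠ 0 := Nat.cast_ne_zero.2 hn.ne'
    rw [div_self (ha n hn).ne', mul_one]
    field_simp
  have hquot := (tendsto_prod_one_add_mul_expMean ha hreg hα t).div hlast one_ne_zero
  rw [div_one] at hquot
  refine (hquot.comp (tendsto_add_atTop_nat 1)).congr fun n => ?_
  have hscale (x : ℝ) : t * (x / a (n + 1)) = t / a (n + 1) * x := by ring
  have hpos := (Real.exp_pos _).trans_le
    (exp_neg_abs_le_one_add_mul_expMean (div_totalLength_mem_Icc ha n.succ_pos)
      (t / a (n + 1) * a (n + 1)))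
  have hmgf := hX.mgf_gluingHeight ha (t / a (n + 1)) n
  simp only [mgf, Function.comp_apply, Pi.div_apply, hscale] at hmgf ⊢
  rw [hmgf, Finset.prod_Icc_succ_top (Nat.le_add_left 1 n), mul_div_cancel_right₀ _ hpos.ne']

theorem integrable_exp_mul_gluingHeight_div (hX : IsGluing P a X) (ha : ∀ n, 1 ≤ n → 0 < a n)
    (c t : ℝ) (n : ℕ) : Integrable (fun ω => Real.exp (t * (gluingHeight X n ω / c))) P := by
  convert! hX.integrable_exp_mul_gluingHeight ha (t / c) n using 3
  ring

variable {Ω' : Type*} [MeasurableSpace Ω'] {P' : Measure Ω'} [IsProbabilityMeasure P']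
  {α : ℝ} {ξ : Ω' → ℝ}

theorem exists_isXiLaw (hX : IsGluing P a X) (ha : ∀ n, 1 ≤ n → 0 < a n)
    (hreg : RegularlyVarying a α) (hα : 0 < α) :
    ∃ ν : ProbabilityMeasure ℝ, IsXiLaw α (ν : Measure ℝ) := by
  obtain ⟨ν, -, hν⟩ := exists_tendstoInDistribution_of_tendsto_mgf
    (fun n => ((hX.measurable_gluingHeight n).div_const (a (n + 1))).aemeasurable)
    (fun n t => hX.integrable_exp_mul_gluingHeight_div ha _ t n)
    (hX.tendsto_mgf_gluingHeight_div ha hreg hα)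
  exact ⟨ν, hν⟩

theorem tendstoInDistribution_gluingHeight_div (hX : IsGluing P a X)
    (ha : ∀ n, 1 ≤ n → 0 < a n) (hreg : RegularlyVarying a α) (hα : 0 < α) (hξ : Measurable ξ)
    (hlaw : IsXiLaw α (P'.map ξ)) :
    TendstoInDistribution (fun n ω => gluingHeight X n ω / a (n + 1)) atTop ξ (fun _ => P) P' := by
  refine tendstoInDistribution_of_tendsto_mgf
    (fun n => ((hX.measurable_gluingHeight n).div_const _).aemeasurable)
    (fun n t => hX.integrable_exp_mul_gluingHeight_div ha _ t n) hξ.aemeasurable fun t => ?_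
  have hmgf : mgf ξ P' t = Real.exp (phi α t) := by
    rw [← mgf_id_map hξ.aemeasurable]
    exact (hlaw t).2
  rw [hmgf]
  exact hX.tendsto_mgf_gluingHeight_div ha hreg hα t

theorem tendstoInDistribution_height_leaf_div (hX : IsGluing P a X) (ha : ∀ n, 1 ≤ n → 0 < a n)
    (hreg : RegularlyVarying a α) (hα : 0 < α) (hξ : Measurable ξ)
    (hlaw : IsXiLaw α (P'.map ξ)) :
    TendstoInDistribution
      (fun n ω => height (fun k => X k ω) (n + 1) (leaf a (n + 1)) / a (n + 1))
      atTop (fun ω' => 1 + ξ ω') (fun _ => P) P' := by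
  have hlim := (hX.tendstoInDistribution_gluingHeight_div ha hreg hα hξ hlaw).continuous_comp
    (g := fun x => 1 + x) (by fun_prop)
  refine hlim.congr (fun n => ae_of_all _ fun ω => ?_) (ae_of_all _ fun _ => rfl)
  have han := ha (n + 1) n.succ_pos
  simp only [Function.comp_apply, leaf, height_succ_mk _ n han.le, gluingHeight]
  rw [add_div, div_self han.ne']

theorem tendstoInDistribution_height_leaf_floor_div_floor (hX : IsGluing P a X)
    (ha : ∀ n, 1 ≤ n → 0 < a n) (hreg : RegularlyVarying a α) (hα : 0 < α) (hξ : Measurable ξ)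
    (hlaw : IsXiLaw α (P'.map ξ)) {x : ℝ} (hx : 0 < x) :
    TendstoInDistribution
      (fun (n : ℕ) ω => height (fun k => X k ω) ⌊x * (n : ℝ)⌋₊ (leaf a ⌊x * (n : ℝ)⌋₊) /
        a ⌊x * (n : ℝ)⌋₊) atTop (fun ω' => 1 + ξ ω') (fun _ => P) P' := by
  have hleaf := hX.tendstoInDistribution_height_leaf_div ha hreg hα hξ hlaw
  have hmeas (m : ℕ) : AEMeasurable (fun ω => height (fun k => X k ω) m (leaf a m) / a m) P :=
    ((hX.measurable_height m measurable_const).div_const _).aemeasurable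
  have hlaws : Tendsto (β := ProbabilityMeasure ℝ)
      (fun m => ⟨P.map fun ω => height (fun k => X k ω) m (leaf a m) / a m,
        Measure.isProbabilityMeasure_map (hmeas m)⟩) atTop
      (𝓝 ⟨P'.map fun ω' => 1 + ξ ω',
        Measure.isProbabilityMeasure_map hleaf.aemeasurable_limit⟩) :=
    (tendsto_add_atTop_iff_nat 1).1 hleaf.tendsto
  exact ⟨fun n => hmeas _, hleaf.aemeasurable_limit,
    hlaws.comp (tendsto_floor_mul_natCast_atTop hx)⟩

theorem tendstoInDistribution_height_leaf_floor_div (hX : IsGluing P a X)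
    (ha : ∀ n, 1 ≤ n → 0 < a n) (hreg : RegularlyVarying a α) (hα : 0 < α) (hξ : Measurable ξ)
    (hlaw : IsXiLaw α (P'.map ξ)) {x : ℝ} (hx : 0 < x) :
    TendstoInDistribution
      (fun (n : ℕ) ω => height (fun k => X k ω) ⌊x * (n : ℝ)⌋₊ (leaf a ⌊x * (n : ℝ)⌋₊) / a n)
      atTop (fun ω' => (1 + ξ ω') * x ^ α) (fun _ => P) P' := by
  have hratio : TendstoInMeasure P (fun (n : ℕ) (_ : Ω) => a ⌊x * (n : ℝ)⌋₊ / a n) atTop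
      (fun _ => x ^ α) :=
    tendstoInMeasure_of_tendsto_ae (fun n => aestronglyMeasurable_const)
      (ae_of_all _ fun _ => hreg x hx)
  have hprod := (hX.tendstoInDistribution_height_leaf_floor_div_floor ha hreg hα hξ hlaw
    hx).continuous_comp_prodMk_of_tendstoInMeasure_const
    (g := fun y : ℝ × ℝ => y.1 * y.2) (by fun_prop) hratio fun n => aemeasurable_const
  refine hprod.congr (fun n => ae_of_all _ fun ω => ?_) (ae_of_all _ fun _ => rfl)
  rcases Nat.eq_zero_or_pos ⌊x * (n : ℝ)⌋₊ with hzero | hpos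
  · simp [hzero, height, treeDist]
  · exact div_mul_div_cancel₀ (ha _ hpos).ne'

end IsGluing

theorem IsXiLaw.unique {α : ℝ} {μ ν : ProbabilityMeasure ℝ} (hμ : IsXiLaw α (μ : Measure ℝ))
    (hν : IsXiLaw α (ν : Measure ℝ)) : μ = ν :=
  Subtype.ext <| ext_of_mgf_id_eq (μ := (μ : Measure ℝ)) (ν := (ν : Measure ℝ)) (fun t => (hμ t).1)
    (funext fun t => (hμ t).2.trans (hν t).2.symm)

section RandomLeaf

variable {Ω : Type*} [MeasurableSpace Ω] {P : Measure Ω} [IsProbabilityMeasure P] {a : ℕ → ℝ}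
  {X : ℕ → Ω → ℕ × ℝ}

theorem IsUniformLeafIndex.integral_height_leaf {n : ℕ} {J : Ω → ℕ}
    (hJ : IsUniformLeafIndex P X n J) (hX : IsGluing P a X) {f : ℝ → ℝ} (hf : Measurable f)
    {C : ℝ} (hC : ∀ x, |f x| ≤ C) :
    ∫ ω, f (height (fun k => X k ω) n (leaf a (J ω))) ∂P =
      ∑ k ∈ Finset.Icc 1 n, (∫ ω, f (height (fun k => X k ω) k (leaf a k)) ∂P) / n := by
  have hF : Measurable fun x : ℕ × (Finset.Ico 1 n → ℕ × ℝ) => f (heightOn n x.2 (leaf a x.1)) :=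
    hf.comp ((measurable_heightOn n).comp
      (((measurable_from_nat (f := leaf a)).comp measurable_fst).prodMk measurable_snd))
  have hindep := integral_comp_prodMk_of_indepFun hJ.indep hJ.measurable
    (hX.measurable_restrict n) hF fun _ => hC _
  simp only [heightOn_restrict X] at hindep
  rw [hindep, integral_map_of_isUniform_finset (s := Finset.Icc 1 n)
    (by simpa using hJ.uniform), Nat.card_Icc, Nat.add_sub_cancel]
  refine Finset.sum_congr rfl fun k hk => ?_
  obtain ⟨hk1, hkn⟩ := Finset.mem_Icc.1 hk
  simp only [height_of_le _ hk1 (p := leaf a k) le_rfl hkn]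

end RandomLeaf

section Limit

variable {Ω' : Type*} [MeasurableSpace Ω'] {P' : Measure Ω'} [IsProbabilityMeasure P']
  {ξ U : Ω' → ℝ} {α : ℝ}

variable {Ω : Type*} [MeasurableSpace Ω] {P : Measure Ω} [IsProbabilityMeasure P] {a : ℕ → ℝ}
  {X : ℕ → Ω → ℕ × ℝ}

theorem IsGluing.tendsto_average_integral_height_leaf (hX : IsGluing P a X)
    (ha : ∀ n, 1 ≤ n → 0 < a n) (hreg : RegularlyVarying a α) (hα : 0 < α) (hξ : Measurable ξ)
    (hlaw : IsXiLaw α (P'.map ξ)) (f : BoundedContinuousFunction ℝ ℝ) :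
    Tendsto (fun n : ℕ => ∑ k ∈ Finset.Icc 1 n,
      (∫ ω, f (height (fun k => X k ω) k (leaf a k) / a n) ∂P) / n) atTop
      (𝓝 (∫ x in (0 : ℝ)..1, ∫ ω', f ((1 + ξ ω') * x ^ α) ∂P')) := by
  refine tendsto_sum_Icc_of_dominated (C := ‖f‖) (β := 0) (by norm_num) le_rfl
    (fun n k _ _ => ?_) fun x hx => ?_
  · have hbound := norm_integral_le_of_norm_le_const (μ := P)
      (ae_of_all _ fun ω => f.norm_coe_le_norm (height (fun k => X k ω) k (leaf a k) / a n))
    rw [probReal_univ, mul_one, Real.norm_eq_abs] at hbound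
    rw [abs_div, Nat.abs_cast, Real.rpow_zero, mul_one]
    gcongr
  · have hleaf := hX.tendstoInDistribution_height_leaf_floor_div ha hreg hα hξ hlaw hx.1
    have hlim := ProbabilityMeasure.tendsto_iff_forall_integral_tendsto.1 hleaf.tendsto f
    simp only [ProbabilityMeasure.coe_mk] at hlim
    rw [integral_map hleaf.aemeasurable_limit f.continuous.aestronglyMeasurable] at hlim
    refine hlim.congr' ?_
    filter_upwards [eventually_gt_atTop 0] with n hn
    rw [integral_map (hleaf.forall_aemeasurable n) f.continuous.aestronglyMeasurable,
      mul_div_cancel₀ _ (Nat.cast_ne_zero.2 hn.ne')]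

theorem IsGluing.tendstoInDistribution_height_uniform_leaf_div (hX : IsGluing P a X)
    (ha : ∀ n, 1 ≤ n → 0 < a n) (hreg : RegularlyVarying a α) (hα : 0 < α) {J : ℕ → Ω → ℕ}
    (hJ : ∀ n, 1 ≤ n → IsUniformLeafIndex P X n (J n)) (hξ : Measurable ξ) (hU : Measurable U)
    (hlaw : IsXiLaw α (P'.map ξ)) (hunif : pdf.IsUniform U (Set.Ioo 0 1) P' volume)
    (hind : IndepFun ξ U P') :
    TendstoInDistribution
      (fun n ω => height (fun k => X k ω) (n + 1) (leaf a (J (n + 1) ω)) / a (n + 1))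
      atTop (fun ω' => (1 + ξ ω') * U ω' ^ α) (fun _ => P) P' := by
  have hmeas (n : ℕ) : AEMeasurable
      (fun ω => height (fun k => X k ω) (n + 1) (leaf a (J (n + 1) ω)) / a (n + 1)) P :=
    ((hX.measurable_height (n + 1) ((measurable_from_nat (f := leaf a)).comp
      (hJ (n + 1) n.succ_pos).measurable)).div_const _).aemeasurable
  have hlimit : AEMeasurable (fun ω' => (1 + ξ ω') * U ω' ^ α) P' := by fun_prop
  refine ⟨hmeas, hlimit, ProbabilityMeasure.tendsto_iff_forall_integral_tendsto.2 fun f => ?_⟩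
  simp only [ProbabilityMeasure.coe_mk]
  rw [integral_map hlimit f.continuous.aestronglyMeasurable,
    integral_comp_prodMk_of_isUniform_Ioo hU hξ hunif hind.symm
      (F := fun x => f ((1 + x.2) * x.1 ^ α)) (f.continuous.measurable.comp (by fun_prop))
      fun _ => f.norm_coe_le_norm _]
  refine ((hX.tendsto_average_integral_height_leaf ha hreg hα hξ hlaw f).comp
    (tendsto_add_atTop_nat 1)).congr fun n => ?_
  rw [integral_map (hmeas n) f.continuous.aestronglyMeasurable]
  exact ((hJ (n + 1) n.succ_pos).integral_height_leaf hX
    (f := fun x => f (x / a (n + 1))) (f.continuous.measurable.comp (by fun_prop))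
    fun _ => f.norm_coe_le_norm _).symm

end Limit

end LineBreaking

theorem mainTheorem7 (α : ℝ) (hα : 0 < α) (a : ℕ → ℝ) (ha : ∀ n, 1 ≤ n → 0 < a n)
    (hreg : RegularlyVarying a α)
    {Ω : Type*} [MeasurableSpace Ω] (P : Measure Ω) [IsProbabilityMeasure P]
    (X : ℕ → Ω → ℕ × ℝ) (hX : LineBreaking.IsGluing P a X)
    (J : ℕ → Ω → ℕ) (hJ : ∀ n, 1 ≤ n → LineBreaking.IsUniformLeafIndex P X n (J n)) :
    (∃! ν : ProbabilityMeasure ℝ, LineBreaking.IsXiLaw α (ν : Measure ℝ)) ∧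
    ∀ {Ω' : Type*} [MeasurableSpace Ω'] (P' : Measure Ω') [IsProbabilityMeasure P']
      (ξ U : Ω' → ℝ), Measurable ξ → Measurable U →
      LineBreaking.IsXiLaw α (P'.map ξ) →
      pdf.IsUniform U (Set.Ioo 0 1) P' volume →
      IndepFun ξ U P' →
      TendstoInDistribution
        (fun (n : ℕ) (ω : Ω) =>
          LineBreaking.treeDist (fun k => X k ω) (n + 1)
            (LineBreaking.leaf a (n + 1)) LineBreaking.root / a (n + 1))
        atTop (fun ω' => 1 + ξ ω') (fun _ => P) P' ∧
      TendstoInDistribution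
        (fun (n : ℕ) (ω : Ω) =>
          LineBreaking.treeDist (fun k => X k ω) (n + 1)
            (LineBreaking.leaf a (J (n + 1) ω)) LineBreaking.root / a (n + 1))
        atTop (fun ω' => (1 + ξ ω') * U ω' ^ α) (fun _ => P) P' := by
  obtain ⟨ν, hν⟩ := hX.exists_isXiLaw ha hreg hα
  refine ⟨⟨ν, hν, fun ν' hν' => hν'.unique hν⟩, fun P' _ ξ U hξ hU hlaw hunif hind => ⟨?_, ?_⟩⟩
  · exact hX.tendstoInDistribution_height_leaf_div ha hreg hα hξ hlaw
  · exact hX.tendstoInDistribution_height_uniform_leaf_div ha hreg hα hJ hξ hU hlaw hunif hind
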